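/- Let $n\ge 2$ and $k\ge 0$, and let $P_k^+$ be the set of dominant integral weights of $\widehat{\mathfrak{su}}(n)$ at level $k$, i.e. of tuples of Dynkin labels $\hat\mu=(m_1,\dots,m_n)\in\mathbb Z_{\ge0}^n$ with $\sum_i m_i=k$, where the label $n$ belongs to the affine node. Identify $\hat\mu$ with the partition $\mu=(\mu_1,\dots,\mu_{n-1})$ with $\mu_1\le k$ and $\mu_i-\mu_{i+1}=m_i$ for $1\le i\le n-1$ (where $\mu_n=0$); write $\hat\lambda\in P_k^+$ for the weight of such a partition $\lambda$. Let $S$ be the modular matrix $$S_{\hat\lambda\hat\sigma}=\frac{e^{i\pi n(n-1)/4}}{\sqrt{n(k+n)^{n-1}}}\sum_{w\in S_n}(-1)^{\ell(w)}e^{-\frac{2\pi i}{k+n}(\sigma+\rho,\,w(\lambda+\rho))},$$ where $\rho$ is the Weyl vector of $\mathfrak{su}(n)$ and $\lambda,\sigma$ denote the finite parts of the weights, and let the fusion coefficients at level $k$ be defined by the Verlinde formula $$\mathcal N^{(k),\hat\nu}_{\hat\lambda\hat\mu}=\sum_{\hat\sigma\in P_k^+}\frac{S_{\hat\lambda\hat\sigma}S_{\hat\mu\hat\sigma}S^{-1}_{\hat\nu\hat\sigma}}{S_{\hat\emptyset\hat\sigma}}.$$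 Let $\varphi_i^*:P_k^+\to P_{k+1}^+$ raise the label $m_i$ by one, and let $\varphi_i$ lower $m_i>0$ by one and send a weight with $m_i=0$ to $0$. A fusion coefficient one of whose arguments is $0$ is $0$. For a partition $\lambda$ with at most $n$ parts let $\lambda'$ be the partition obtained by deleting all columns of height $n$ from its Young diagram. A skew diagram $\lambda/\mu$ (with $\mu\subseteq\lambda$) is a vertical (horizontal) $r$-strip if it consists of $r$ boxes, no two of which are in the same row (column). Proposition. Let $\hat\mu,\hat\nu\in P_k^+$. (a) Let $0\le r\le n-1$, where $k\ge1$ if $r>0$. Then $\mathcal N^{(k),\hat\nu}_{\widehat{(1^r)}\,\hat\mu}=1$ if one of the following two conditions holds, and $\mathcal N^{(k),\hat\nu}_{\widehat{(1^r)}\,\hat\mu}=0$ otherwise. 1. There is a partition $\lambda$ with at most $n$ parts and $\lambda_1\le k$ such that $\lambda'=\nu$, $\lambda_1=\mu_1$ and $\lambda/\mu$ is a vertical $r$-strip. 2. $r\ge1$, and there is a partition $\lambda$ with at most $n$ parts and $\lambda_1\le k+1$ such that $\lambda'$ is the partition of $\varphi_n^*\hat\nu$, $\lambda_1=\mu_1+1$,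 and $\lambda/\tilde\mu$ is a vertical $(r-1)$-strip, where $\tilde\mu$ is the partition of $\varphi_1^*\hat\mu$. (b) Let $0\le r\le k$. If there is a partition $\lambda$ with at most $n$ parts and $\lambda_1\le k$ such that $\lambda'=\nu$, $\lambda_1=\mu_1$ and $\lambda/\mu$ is a horizontal $r$-strip, then $\mathcal N^{(k),\hat\nu}_{\widehat{(r)}\,\hat\mu}=1$. Otherwise $$\mathcal N^{(k),\hat\nu}_{\widehat{(r)}\,\hat\mu}=\mathcal N^{(k-1),\varphi_1\hat\nu}_{\widehat{(r-1)}\,\varphi_n\hat\mu},$$ where the right-hand side is $0$ if $r=0$, $\varphi_n\hat\mu=0$ or $\varphi_1\hat\nu=0$. -/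

import Mathlib

noncomputable section

namespace SuFusion

/-- Dominant integral weights of affine `su(n)` at level `k`, given by their Dynkin labels:
`n`-tuples of non-negative integers with sum `k`. The node `i = 1, …, n` of the Dynkin diagram
is the index `i - 1` of `Fin n`; in particular the affine node `n` is the index `n - 1`. -/
abbrev Weight (n k : ℕ) : Type := {m : Fin n → ℕ // ∑ i, m i = k}

instance (n k : ℕ) : Fintype (Weight n k) :=
  Fintype.subtype (Finset.piAntidiag Finset.univ k) (fun m => by simp)

/-- The index of the node `1`. -/
def node1 (n : ℕ) [NeZero n] : Fin n := 0

/-- The index of the affine node `n`. -/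
def nodeN (n : ℕ) [NeZero n] : Fin n := ⟨n - 1, Nat.sub_lt (NeZero.pos n) one_pos⟩

/-- The operator `φ_i^*`, which raises the Dynkin label `m_i` by one. -/
def phiStar {n k : ℕ} (i : Fin n) (m : Weight n k) : Weight n (k + 1) :=
  ⟨fun j => if j = i then m.1 j + 1 else m.1 j, by
    have h : (fun j => if j = i then m.1 j + 1 else m.1 j)
        = fun j => m.1 j + if j = i then 1 else 0 := by
      funext j; split_ifs <;> rfl
    rw [h, Finset.sum_add_distrib, m.2]; simp⟩

/-- The operator `φ_i`, which lowers the Dynkin label `m_i` by one, on the weights with `m_i > 0`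
(it sends the other weights to the zero vector). -/
def phi {n k : ℕ} (i : Fin n) (m : Weight n k) (h : 0 < m.1 i) : Weight n (k - 1) :=
  ⟨fun j => if j = i then m.1 j - 1 else m.1 j, by
    have h1 : (∑ j, if j = i then m.1 j - 1 else m.1 j) + 1 = k := by
      have h2 : (∑ j, ((if j = i then m.1 j - 1 else m.1 j) + if j = i then 1 else 0)) = k := by
        refine (Finset.sum_congr rfl fun j _ => ?_).trans m.2
        split_ifs with hj
        · subst hj; omega
        · rfl
      rw [Finset.sum_add_distrib] at h2
      simpa using h2
    exact Nat.eq_sub_of_add_eq h1⟩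

/-- The part `λ_{i+1} = m_{i+1} + ⋯ + m_{n-1}` of the partition of a weight, so that
`λ_i - λ_{i+1} = m_i` for `1 ≤ i ≤ n - 1` and `λ_n = λ_{n+1} = ⋯ = 0`. -/
def part {n k : ℕ} (m : Weight n k) (i : ℕ) : ℕ :=
  ∑ j : Fin n with i ≤ j.1 ∧ j.1 + 1 < n, m.1 j

theorem part_anti {n k : ℕ} (m : Weight n k) {i i' : ℕ} (h : i ≤ i') : part m i' ≤ part m i := by
  apply Finset.sum_le_sum_of_subset
  intro j
  simp only [Finset.mem_filter, Finset.mem_univ, true_and]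
  omega

/-- The partition (Young diagram) `λ` of the weight `λ̂`. -/
def diagram {n k : ℕ} (m : Weight n k) : YoungDiagram where
  cells := (Finset.range n ×ˢ Finset.range (part m 0)).filter fun c => c.2 < part m c.1
  isLowerSet := by
    rintro ⟨i, j⟩ ⟨i', j'⟩ hle hmem
    simp only [Prod.mk_le_mk] at hle
    simp only [Finset.coe_filter, Finset.mem_product, Finset.mem_range, Set.mem_ofPred_eq]
      at hmem ⊢
    have h1 := part_anti m hle.1
    omega

/-- The weight `λ̂` at level `k` of a partition `λ` with fewer than `n` rows and at most `k` columns. -/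
def hat {n k : ℕ} (lam : YoungDiagram) (hn : lam.colLen 0 < n) (hk : lam.rowLen 0 ≤ k) :
    Weight n k :=
  ⟨fun i => if i.1 + 1 < n then lam.rowLen i.1 - lam.rowLen (i.1 + 1) else k - lam.rowLen 0, by
    obtain ⟨N, rfl⟩ : ∃ N, n = N + 1 := ⟨n - 1, by omega⟩
    rw [Fin.sum_univ_castSucc]
    have h0 : lam.rowLen N = 0 := by
      by_contra hne
      have := (YoungDiagram.mem_iff_lt_colLen (μ := lam) (i := N) (j := 0)).1
        (YoungDiagram.mem_iff_lt_rowLen.2 (Nat.pos_of_ne_zero hne))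
      omega
    have h1 : ∀ M, (∑ i ∈ Finset.range M, (lam.rowLen i - lam.rowLen (i + 1)))
        = lam.rowLen 0 - lam.rowLen M := by
      intro M
      induction M with
      | zero => simp
      | succ M ih =>
        rw [Finset.sum_range_succ, ih]
        have := lam.rowLen_anti M (M + 1) (by omega)
        have := lam.rowLen_anti 0 M (by omega)
        omega
    have h2 : (∑ i : Fin N, (lam.rowLen i.1 - lam.rowLen (i.1 + 1))) = lam.rowLen 0 := by
      rw [Fin.sum_univ_eq_sum_range (fun i => lam.rowLen i - lam.rowLen (i + 1)) N, h1, h0]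
      omega
    simp only [Fin.val_castSucc, Fin.val_last, Nat.add_lt_add_iff_right, Fin.is_lt, if_true,
      lt_irrefl, if_false, h2]
    omega⟩

theorem mem_diagram {n k : ℕ} {m : Weight n k} {i j : ℕ} :
    (i, j) ∈ diagram m ↔ j < part m i := by
  rw [← YoungDiagram.mem_cells]
  simp only [diagram, Finset.mem_filter, Finset.mem_product, Finset.mem_range]
  refine ⟨fun h => h.2, fun h => ⟨⟨?_, h.trans_le (part_anti m (Nat.zero_le i))⟩, h⟩⟩
  by_contra hi
  have h0 : part m i = 0 := by
    apply Finset.sum_eq_zero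
    intro a ha
    simp only [Finset.mem_filter, Finset.mem_univ, true_and] at ha
    omega
  omega

theorem rowLen_diagram {n k : ℕ} (m : Weight n k) (i : ℕ) : (diagram m).rowLen i = part m i := by
  apply le_antisymm
  · by_contra h
    exact lt_irrefl _ (mem_diagram.1 (YoungDiagram.mem_iff_lt_rowLen.2 (not_le.1 h)))
  · by_contra h
    exact lt_irrefl _ (YoungDiagram.mem_iff_lt_rowLen.1 (mem_diagram.2 (not_le.1 h)))

/-- The partition of the weight `λ̂` is `λ`. -/
theorem diagram_hat {n k : ℕ} (lam : YoungDiagram) (hn : lam.colLen 0 < n)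
    (hk : lam.rowLen 0 ≤ k) : diagram (hat (k := k) lam hn hk) = lam := by
  have h0 : ∀ i, n ≤ i + 1 → lam.rowLen i = 0 := by
    intro i hi
    by_contra hne
    have := (YoungDiagram.mem_iff_lt_colLen (μ := lam) (i := i) (j := 0)).1
      (YoungDiagram.mem_iff_lt_rowLen.2 (Nat.pos_of_ne_zero hne))
    omega
  have key : ∀ d i, n ≤ i + 1 + d → part (hat (k := k) lam hn hk) i = lam.rowLen i := by
    intro d
    induction d with
    | zero =>
      intro i hi
      rw [h0 i (by omega)]
      apply Finset.sum_eq_zero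
      intro a ha
      simp only [Finset.mem_filter, Finset.mem_univ, true_and] at ha
      omega
    | succ d ih =>
      intro i hi
      by_cases hi' : n ≤ i + 1 + d
      · exact ih i hi'
      · have h1 := ih (i + 1) (by omega)
        have h2 : part (hat (k := k) lam hn hk) i
            = (hat (k := k) lam hn hk).1 ⟨i, by omega⟩ + part (hat (k := k) lam hn hk) (i + 1) := by
          unfold part
          rw [← Finset.sum_insert (by simp)]
          refine Finset.sum_congr ?_ fun _ _ => rfl
          ext a
          simp only [Finset.mem_filter, Finset.mem_univ, true_and, Finset.mem_insert, Fin.ext_iff]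
          omega
        rw [h2, h1]
        have := lam.rowLen_anti i (i + 1) (by omega)
        simp only [hat]
        rw [if_pos (by omega)]
        omega
  ext ⟨i, j⟩
  rw [YoungDiagram.mem_cells, YoungDiagram.mem_cells, mem_diagram, key n i (by omega),
    YoungDiagram.mem_iff_lt_rowLen]

/-- The rectangular Young diagram with `a` rows and `b` columns. -/
def rect (a b : ℕ) : YoungDiagram where
  cells := Finset.range a ×ˢ Finset.range b
  isLowerSet := by
    rintro ⟨i, j⟩ ⟨i', j'⟩ hle hmem
    simp only [Prod.mk_le_mk] at hle
    simp only [Finset.coe_product, Finset.coe_range, Set.mem_prod, Set.mem_Iio] at hmem ⊢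
    omega

theorem mem_rect {a b : ℕ} {c : ℕ × ℕ} : c ∈ rect a b ↔ c.1 < a ∧ c.2 < b := by
  rw [← YoungDiagram.mem_cells]
  simp [rect]

theorem colLen_rect_le (a b : ℕ) : (rect a b).colLen 0 ≤ a := by
  by_contra h
  have := mem_rect.1 (YoungDiagram.mem_iff_lt_colLen.2 (not_le.1 h))
  simp at this

theorem rowLen_rect_le (a b : ℕ) : (rect a b).rowLen 0 ≤ b := by
  by_contra h
  have := mem_rect.1 (YoungDiagram.mem_iff_lt_rowLen.2 (not_le.1 h))
  simp at this

theorem rowLen_rect_zero (b : ℕ) : (rect 0 b).rowLen 0 = 0 := by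
  by_contra h
  have := mem_rect.1 (YoungDiagram.mem_iff_lt_rowLen.2 (Nat.pos_of_ne_zero h))
  simp at this

/-- The weight of the empty partition. -/
def emptyWeight (n k : ℕ) [NeZero n] : Weight n k :=
  hat (rect 0 0) ((colLen_rect_le 0 0).trans_lt (NeZero.pos n))
    ((rowLen_rect_le 0 0).trans (Nat.zero_le k))

/-- The weight of the column partition `(1^r)`, where `r < n`. -/
def columnWeight (n k r : ℕ) (hr : r < n) (hk : r = 0 ∨ 0 < k) : Weight n k :=
  hat (rect r 1) ((colLen_rect_le r 1).trans_lt hr) (by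
    rcases hk with rfl | hk
    · rw [rowLen_rect_zero]; exact Nat.zero_le k
    · exact (rowLen_rect_le r 1).trans hk)

/-- The weight of the row partition `(r)`, where `r ≤ k` and `n ≥ 2`. -/
def rowWeight (n k r : ℕ) (hn : 2 ≤ n) (hr : r ≤ k) : Weight n k :=
  hat (rect 1 r) ((colLen_rect_le 1 r).trans_lt hn) ((rowLen_rect_le 1 r).trans hr)

/-- The finite part of a weight, in the orthonormal coordinates of `ℝⁿ` in which the roots of `su(n)`
are `ε_i - ε_j`. -/
def finitePart {n k : ℕ} (m : Weight n k) (i : Fin n) : ℝ :=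
  part m i.1 - (∑ j : Fin n, (part m j.1 : ℝ)) / n

/-- The Weyl vector of `su(n)` in the same coordinates. -/
def weylVector (n : ℕ) (i : Fin n) : ℝ := ((n : ℝ) - 1) / 2 - i.1

/-- The modular `S`-matrix (Kac-Peterson formula); the Weyl group of `su(n)` is the group of
permutations of the coordinates, `w` sending the vector `v` to `i ↦ v (w⁻¹ i)`. -/
def modularS (n k : ℕ) : Matrix (Weight n k) (Weight n k) ℂ :=
  Matrix.of fun lam sig =>
    Complex.exp (Complex.I * Real.pi * n * (n - 1) / 4)
        / ((Real.sqrt ((n : ℝ) * ((k : ℝ) + n) ^ (n - 1)) : ℝ) : ℂ) *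
      ∑ w : Equiv.Perm (Fin n), ((Equiv.Perm.sign w : ℤ) : ℂ) *
        Complex.exp (-(2 * Real.pi * Complex.I / ((k : ℂ) + n)) *
          ((∑ i : Fin n, (finitePart sig i + weylVector n i) *
            (finitePart lam (w⁻¹ i) + weylVector n (w⁻¹ i)) : ℝ) : ℂ))

/-- The fusion coefficient of `λ̂`, `μ̂`, `ν̂` at level `k` (Verlinde formula). -/
def fusionCoeff {n k : ℕ} [NeZero n] (lam mu nu : Weight n k) : ℂ :=
  ∑ sig : Weight n k,
    modularS n k lam sig * modularS n k mu sig * (modularS n k)⁻¹ nu sig /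
      modularS n k (emptyWeight n k) sig

/-- The diagram `λ'` obtained from `λ` (with at most `n` rows) by deleting all columns of height `n`. -/
def deleteColumns (n : ℕ) (lam : YoungDiagram) : YoungDiagram where
  cells := lam.cells.filter fun c => (c.1, c.2 + lam.rowLen (n - 1)) ∈ lam
  isLowerSet := by
    rintro ⟨i, j⟩ ⟨i', j'⟩ hle hmem
    simp only [Prod.mk_le_mk] at hle
    simp only [Finset.coe_filter, Set.mem_ofPred_eq, YoungDiagram.mem_cells] at hmem ⊢
    exact ⟨lam.up_left_mem hle.1 hle.2 hmem.1, lam.up_left_mem hle.1 (by omega) hmem.2⟩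

/-- `λ` is a partition in the `n × k` bounding box with `λ' = ν`, where `ν` is the partition of `ν̂`.
That is, `λ` is `ν` up to columns of height `n`. -/
def Represents {n k : ℕ} (lam : YoungDiagram) (nu : Weight n k) : Prop :=
  lam.colLen 0 ≤ n ∧ lam.rowLen 0 ≤ k ∧ deleteColumns n lam = diagram nu

/-- `λ/μ` is a vertical strip of length `r`: it has `r` boxes, no two of them in the same row. -/
def IsVerticalStrip (r : ℕ) (lam mu : YoungDiagram) : Prop :=
  mu ≤ lam ∧ (lam.cells \ mu.cells).card = r ∧
    ∀ c ∈ lam.cells \ mu.cells, ∀ d ∈ lam.cells \ mu.cells, c.1 = d.1 → c = d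

/-- `λ/μ` is a horizontal strip of length `r`: it has `r` boxes, no two of them in the same column. -/
def IsHorizontalStrip (r : ℕ) (lam mu : YoungDiagram) : Prop :=
  mu ≤ lam ∧ (lam.cells \ mu.cells).card = r ∧
    ∀ c ∈ lam.cells \ mu.cells, ∀ d ∈ lam.cells \ mu.cells, c.2 = d.2 → c = d

/-- First case for columns: `λ_1 = μ_1` and `λ/μ` is a vertical `r`-strip,
for some `λ` that is `ν` up to `n`-columns. -/
def ColumnCase1 {n k : ℕ} (r : ℕ) (mu nu : Weight n k) : Prop :=
  ∃ lam : YoungDiagram, Represents lam nu ∧ lam.rowLen 0 = (diagram mu).rowLen 0 ∧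
    IsVerticalStrip r lam (diagram mu)

/-- Second case for columns: `λ_1 = μ_1 + 1` and `λ/φ_1^*μ` is a vertical `(r-1)`-strip,
for some `λ` that is `φ_n^*ν` up to `n`-columns. It never occurs for `r = 0`. -/
def ColumnCase2 {n k : ℕ} [NeZero n] (r : ℕ) (mu nu : Weight n k) : Prop :=
  ∃ lam : YoungDiagram, Represents lam (phiStar (nodeN n) nu) ∧
    lam.rowLen 0 = (diagram mu).rowLen 0 + 1 ∧
    ∃ s : ℕ, s + 1 = r ∧ IsVerticalStrip s lam (diagram (phiStar (node1 n) mu))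

/-- First case for rows: `λ_1 = μ_1` and `λ/μ` is a horizontal `r`-strip,
for some `λ` that is `ν` up to `n`-columns. -/
def RowCase {n k : ℕ} (r : ℕ) (mu nu : Weight n k) : Prop :=
  ∃ lam : YoungDiagram, Represents lam nu ∧ lam.rowLen 0 = (diagram mu).rowLen 0 ∧
    IsHorizontalStrip r lam (diagram mu)

end SuFusion

end

/-! The entry of S at `lam`, `sig` is a nonzero scalar times the alternant with the shifted parts of
`lam` as exponents, at n points attached to `sig` (`modularS_eq`). These points are distinct, have
product 1 and share one (k+n)-th power. For such points, multiplying an alternant by an elementary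
symmetric polynomial of degree r adds r boxes in distinct rows, and the terms that survive are
exactly those whose labels stay non-negative around the affine Dynkin cycle
(`verticalPieri_alternant`). This cylindric Pieri rule has no boundary at the affine node.

The rule for horizontal strips follows formally: the alternating sum of e_i against strips of r - i
boxes vanishes by a sign cancellation, so by recursion the strip sum at m is proportional to the
alternant at m, with a factor independent of m (`VerticalPieri.stripSum_mul`). At the empty weight
only one strip exists, whose result is the column or the row weight. Hence the product of its
alternant with that of `mu`, divided by the empty one, is a sum over cylindric strips on `mu`.

The elementary symmetric polynomials separate the weights, which makes S invertible
(`isUnit_det_modularS`). The Verlinde sum then counts the strips leading from `mu` to `nu`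
(`fusionCoeff_eq_card`), and there is at most one (`boxes_unique`).

The conditions of the theorem arise by looking at the first row. Strips without a box there are
ordinary skew diagrams inside the bounding box. If there is a box there, one such box is absorbed
into the labels, by raising m_1 of `mu` and m_n of `nu`, or by lowering m_n of `mu` and m_1 of `nu`.
-/

namespace SuFusion

/-! ### Elementary symmetric polynomials acting on alternating determinants. -/

section Symmetric

variable {n : ℕ}

/-- One box in each row of the set `I`. -/
def indic (I : Finset (Fin n)) (i : Fin n) : ℕ := if i ∈ I then 1 else 0

theorem sum_indic (I : Finset (Fin n)) : ∑ i, indic I i = I.card := by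
  simp [indic]

theorem indic_injective : Function.Injective (indic (n := n)) := by
  intro I J h
  ext i
  have := congrFun h i
  simp only [indic] at this
  split_ifs at this <;> simp_all

theorem exists_eq_indic {b : Fin n → ℕ} (hb : ∀ i, b i ≤ 1) : ∃ I, b = indic I := by
  refine ⟨Finset.univ.filter fun i => b i = 1, ?_⟩
  funext i
  have := hb i
  simp only [indic, Finset.mem_filter, Finset.mem_univ, true_and]
  split_ifs <;> omega

/-- The elementary symmetric polynomial of degree `r` at the points `X`. -/
noncomputable def elem (X : Fin n → ℂ) (r : ℕ) : ℂ :=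
  ∑ I ∈ Finset.powersetCard r (Finset.univ : Finset (Fin n)), ∏ i ∈ I, X i

theorem elem_zero (X : Fin n → ℂ) : elem X 0 = 1 := by simp [elem]

theorem elem_perm (X : Fin n → ℂ) (r : ℕ) (w : Equiv.Perm (Fin n)) :
    elem (X ∘ w) r = elem X r := by
  unfold elem
  refine Finset.sum_equiv (Equiv.finsetCongr w) (fun I => ?_) (fun I _ => ?_)
  · simp [Finset.mem_powersetCard]
  · simp [Finset.prod_map]

/-- In the term of the permutation `w`, the symmetric factor may be evaluated at `X ∘ w`. The
monomial of `I` then raises exactly the exponents of the columns in `I`. -/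
theorem elem_mul_det (X : Fin n → ℂ) (l : Fin n → ℕ) (r : ℕ) :
    elem X r * (Matrix.of fun i j => X i ^ l j).det =
      ∑ I ∈ Finset.powersetCard r Finset.univ,
        (Matrix.of fun i j => X i ^ (l j + indic I j)).det := by
  simp only [Matrix.det_apply', Matrix.of_apply, Finset.mul_sum]
  rw [Finset.sum_comm]
  refine Finset.sum_congr rfl fun w _ => ?_
  rw [← elem_perm X r w, elem, Finset.sum_mul]
  refine Finset.sum_congr rfl fun I _ => ?_
  simp only [pow_add, Finset.prod_mul_distrib]
  have : ∏ i, X (w i) ^ indic I i = ∏ i ∈ I, (X ∘ w) i := by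
    rw [← Finset.prod_subset (Finset.subset_univ I)]
    · exact Finset.prod_congr rfl fun i hi => by simp [indic, hi]
    · intro i _ hi
      simp [indic, hi]
  rw [this]
  ring

/-- This is the invariance of su(n) characters under deletion of columns of height n. -/
theorem det_pow_add (X : Fin n → ℂ) (hX : ∏ i, X i = 1) (l : Fin n → ℕ) (c : ℕ) :
    (Matrix.of fun i j => X i ^ (l j + c)).det = (Matrix.of fun i j => X i ^ l j).det := by
  have := Matrix.det_mul_column (fun i => X i ^ c) (Matrix.of fun i j => X i ^ l j)
  rw [Finset.prod_pow, hX, one_pow, one_mul] at this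
  rw [← this]
  congr 1
  ext i j
  simp [pow_add, mul_comm]

/-- The elementary symmetric polynomials determine the set of points. -/
theorem exists_eq_of_elem_eq {X Y : Fin n → ℂ} (h : ∀ r, elem X r = elem Y r) (j : Fin n) :
    ∃ i, X i = Y j := by
  have key : ∀ (X : Fin n → ℂ) (t : ℂ), ∏ i, (X i + t)
      = ∑ r ∈ Finset.range (n + 1), elem X r * t ^ (n - r) := by
    intro X t
    rw [Finset.prod_add, Finset.sum_powerset, Finset.card_univ, Fintype.card_fin]
    refine Finset.sum_congr rfl fun r _ => ?_
    rw [elem, Finset.sum_mul]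
    refine Finset.sum_congr rfl fun I hI => ?_
    rw [Finset.prod_const, Finset.card_sdiff_of_subset (Finset.subset_univ I),
      (Finset.mem_powersetCard.1 hI).2, Finset.card_univ, Fintype.card_fin]
  -- The coefficients of ∏ (X i + t) agree with those of ∏ (Y i + t), which vanishes at t = -Y j.
  have h1 : ∏ i, (X i + -Y j) = 0 := by
    rw [key, Finset.sum_congr rfl fun r _ => by rw [h r], ← key]
    exact Finset.prod_eq_zero (Finset.mem_univ j) (by ring)
  obtain ⟨i, _, hi⟩ := Finset.prod_eq_zero_iff.1 h1
  exact ⟨i, by linear_combination hi⟩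

end Symmetric

/-! ### Strips of boxes on the cylinder, and the passage from the vertical to the horizontal Pieri
rule. -/

section Cyclic

variable {n : ℕ} [NeZero n]

theorem val_add_one {i : Fin n} (h : i.1 + 1 < n) : (i + 1).1 = i.1 + 1 := by
  rw [Fin.val_add, Fin.val_one', Nat.add_mod_mod, Nat.mod_eq_of_lt h]

theorem add_one_eq_zero {i : Fin n} (h : ¬ i.1 + 1 < n) : i + 1 = 0 := by
  have h1 : i.1 + 1 = n := by have := i.2; omega
  apply Fin.ext
  rw [Fin.val_add, Fin.val_one', Nat.add_mod_mod, h1, Nat.mod_self, Fin.val_zero]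

theorem nodeN_add_one : nodeN n + 1 = 0 :=
  add_one_eq_zero (by have := NeZero.pos n; simp only [nodeN]; omega)

theorem eq_nodeN_iff {i : Fin n} : i = nodeN n ↔ ¬ i.1 + 1 < n := by
  have := i.2
  rw [Fin.ext_iff, nodeN]
  dsimp only
  omega

theorem add_one_eq_zero_iff {i : Fin n} : i + 1 = 0 ↔ i = nodeN n := by
  rw [← nodeN_add_one]
  exact add_left_inj 1

/-- Induction over the nodes of the cycle. -/
theorem cyclic_induction {p : Fin n → Prop} {a : Fin n} (ha : p a)
    (h : ∀ i, p i → p (i + 1)) (i : Fin n) : p i := by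
  have key : ∀ d : ℕ, p (a + (Fin.ofNat n d)) := by
    intro d
    induction d with
    | zero => simpa using ha
    | succ d ih =>
      have h1 : a + Fin.ofNat n (d + 1) = a + Fin.ofNat n d + 1 := by
        rw [add_assoc]
        congr 1
        apply Fin.ext
        simp [Fin.val_add, Fin.ofNat]
      rw [h1]
      exact h _ ih
  have h2 : a + Fin.ofNat n (i - a).1 = i := by
    rw [Fin.ofNat_val_eq_self]
    exact add_sub_cancel a i
  exact h2 ▸ key _

theorem sum_add_one {M : Type*} [AddCommMonoid M] (f : Fin n → M) :
    ∑ i, f (i + 1) = ∑ i, f i :=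
  Equiv.sum_comp (Equiv.addRight (1 : Fin n)) f

/-- `b i` boxes can be added to the row `i` of the cylindric diagram with labels `m`. -/
def Addable (m b : Fin n → ℕ) : Prop := ∀ i, b (i + 1) ≤ m i + b i

instance (m b : Fin n → ℕ) : Decidable (Addable m b) := by unfold Addable; infer_instance

/-- The `b i` boxes added to the row `i` form a cylindric horizontal strip. -/
def IsStrip (m b : Fin n → ℕ) : Prop := ∀ i, b (i + 1) ≤ m i

instance (m b : Fin n → ℕ) : Decidable (IsStrip m b) := by unfold IsStrip; infer_instance

theorem IsStrip.addable {m b : Fin n → ℕ} (h : IsStrip m b) : Addable m b :=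
  fun i => (h i).trans (Nat.le_add_right _ _)

/-- The labels after the addition of `b i` boxes to the row `i`. -/
def addBoxes (m b : Fin n → ℕ) (i : Fin n) : ℕ := m i + b i - b (i + 1)

theorem addBoxes_eq_iff {m b l : Fin n → ℕ} (h : Addable m b) :
    addBoxes m b = l ↔ ∀ i, l i + b (i + 1) = m i + b i := by
  rw [funext_iff]
  refine forall_congr' fun i => ?_
  have := h i
  simp only [addBoxes]
  omega

theorem addable_of_eq {m b l : Fin n → ℕ} (h : ∀ i, l i + b (i + 1) = m i + b i) :
    Addable m b := fun i => by have := h i; omega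

theorem addBoxes_zero (m : Fin n → ℕ) : addBoxes m 0 = m := by
  funext i; simp [addBoxes]

theorem sum_addBoxes {m b : Fin n → ℕ} (h : Addable m b) : ∑ i, addBoxes m b i = ∑ i, m i := by
  have h1 : ∑ i, (addBoxes m b i + b (i + 1)) = ∑ i, (m i + b i) :=
    Finset.sum_congr rfl fun i _ => (addBoxes_eq_iff h).1 rfl i
  rw [Finset.sum_add_distrib, Finset.sum_add_distrib, sum_add_one] at h1
  omega

theorem addable_addBoxes {m a b : Fin n → ℕ} (h : Addable m a) :
    Addable (addBoxes m a) b ↔ Addable m (a + b) := by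
  refine forall_congr' fun i => ?_
  have := h i
  simp only [addBoxes, Pi.add_apply]
  omega

theorem addBoxes_addBoxes {m a b : Fin n → ℕ} (h : Addable m a) :
    addBoxes (addBoxes m a) b = addBoxes m (a + b) := by
  funext i
  have := h i
  simp only [addBoxes, Pi.add_apply]
  omega

/-- The boxes are determined by the labels before and after, and their number. -/
theorem boxes_unique {m l a b : Fin n → ℕ} (ha : ∀ i, l i + a (i + 1) = m i + a i)
    (hb : ∀ i, l i + b (i + 1) = m i + b i) (hab : ∑ i, a i = ∑ i, b i) : a = b := by
  -- Labels see only differences of adjacent rows, so `a - b` is constant on the cycle; equal totals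
  -- make the constant 0.
  have h1 : ∀ i, (a i : ℤ) - b i = (a 0 : ℤ) - b 0 := by
    refine cyclic_induction (a := 0) rfl fun i hi => ?_
    have := ha i
    have := hb i
    omega
  have h2 : ∑ i : Fin n, ((a i : ℤ) - b i) = 0 := by
    rw [Finset.sum_sub_distrib]
    exact_mod_cast sub_eq_zero.2 (congrArg (Nat.cast : ℕ → ℤ) hab)
  rw [Finset.sum_congr rfl fun i _ => h1 i, Finset.sum_const, Finset.card_univ, Fintype.card_fin,
    nsmul_eq_mul] at h2
  have h3 : (a 0 : ℤ) - b 0 = 0 :=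
    (mul_eq_zero.1 h2).resolve_left (by exact_mod_cast NeZero.ne n)
  funext i
  have := h1 i
  omega

/-- The signed number of ways to split boxes into a horizontal strip and a vertical strip is `0`. -/
theorem signed_sum_eq_zero {m b : Fin n → ℕ} (h : Addable m b) (h0 : 0 < ∑ i, b i)
    (h1 : ∑ i, b i < ∑ i, m i + n) :
    ∑ I ∈ (Finset.univ : Finset (Fin n)).powerset,
      (if (∀ j, indic I j ≤ b j ∧ b j - indic I j ≤ m (j - 1)) then (-1 : ℂ) ^ I.card else 0)
        = 0 := by
  -- At such a `j` the factor of the product below vanishes. Without one, a single empty row forces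
  -- by addability that the next row is empty, hence all of them, against `h0`; with no empty row
  -- the total is `∑ m + n`, against `h1`.
  have hex : ∃ j, b j ≠ 0 ∧ b j ≠ m (j - 1) + 1 := by
    by_contra! hcon
    by_cases hz : ∃ a, b a = 0
    · obtain ⟨a, ha⟩ := hz
      have : ∀ i, b i = 0 := by
        refine cyclic_induction ha fun i hi => ?_
        by_contra hne
        have h2 := hcon _ hne
        rw [add_sub_cancel_right] at h2
        have := h i
        omega
      simp [this] at h0
    · push Not at hz
      have h2 : ∑ i, b i = ∑ i : Fin n, (m (i - 1) + 1) :=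
        Finset.sum_congr rfl fun i _ => hcon i (hz i)
      rw [← sum_add_one] at h2
      simp only [Finset.sum_add_distrib, Finset.sum_const, Finset.card_univ, Fintype.card_fin,
        smul_eq_mul, mul_one] at h2
      rw [← sum_add_one (fun i => m (i - 1)), sum_add_one] at h2
      simp only [add_sub_cancel_right] at h2
      omega
  obtain ⟨j, hj0, hj1⟩ := hex
  -- The signed sum factors over the rows: each row independently gives a box to the vertical strip
  -- (sign -1) or does not (sign +1), and the rest must satisfy the strip bound.
  have key := Finset.prod_add (fun j : Fin n => if 1 ≤ b j ∧ b j - 1 ≤ m (j - 1) then (-1 : ℂ) else 0)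
    (fun j => if b j ≤ m (j - 1) then (1 : ℂ) else 0) Finset.univ
  rw [Finset.prod_eq_zero (Finset.mem_univ j)] at key
  · refine Eq.trans (Finset.sum_congr rfl fun I _ => ?_) key.symm
    have e1 : (∏ i ∈ I, if 1 ≤ b i ∧ b i - 1 ≤ m (i - 1) then (-1 : ℂ) else 0)
        = if (∀ i ∈ I, 1 ≤ b i ∧ b i - 1 ≤ m (i - 1)) then (-1 : ℂ) ^ I.card else 0 := by
      split_ifs with hI
      · rw [Finset.prod_congr rfl fun i hi => if_pos (hI i hi), Finset.prod_const]
      · push Not at hI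
        obtain ⟨i, hi, hi'⟩ := hI
        exact Finset.prod_eq_zero hi (if_neg fun h' => absurd (hi' h'.1) (by omega))
    have e2 : (∏ i ∈ Finset.univ \ I, if b i ≤ m (i - 1) then (1 : ℂ) else 0)
        = if (∀ i ∉ I, b i ≤ m (i - 1)) then 1 else 0 := by
      split_ifs with hI
      · exact Finset.prod_eq_one fun i hi => if_pos (hI i (by simpa using hi))
      · push Not at hI
        obtain ⟨i, hi, hi'⟩ := hI
        exact Finset.prod_eq_zero (i := i) (by simpa using hi) (if_neg (by omega))
    rw [e1, e2, mul_ite, mul_one, mul_zero, ← ite_and]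
    refine if_congr (Iff.trans ?_ and_comm) rfl rfl
    constructor
    · intro hI
      refine ⟨fun i hi => ?_, fun i hi => ?_⟩
      · have := hI i
        simp only [indic, if_pos hi] at this
        exact this
      · have := hI i
        simp only [indic, if_neg hi] at this
        omega
    · rintro ⟨hI, hI'⟩ i
      by_cases hi : i ∈ I
      · simpa only [indic, if_pos hi] using hI i hi
      · simpa only [indic, if_neg hi, Nat.zero_le, true_and, Nat.sub_zero] using hI' i hi
  · split_ifs <;> first | omega | simp

/-- The sum of `F` over all labels obtained by adding a cylindric horizontal strip of `r` boxes. -/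
noncomputable def stripSum (F : (Fin n → ℕ) → ℂ) (r : ℕ) (m : Fin n → ℕ) : ℂ :=
  ∑ a ∈ (Finset.piAntidiag Finset.univ r).filter (IsStrip m), F (addBoxes m a)

/-- `F` satisfies the Pieri rule for vertical strips at level `k`, with the multipliers `e`. -/
def VerticalPieri (k : ℕ) (e : ℕ → ℂ) (F : (Fin n → ℕ) → ℂ) : Prop :=
  ∀ m : Fin n → ℕ, ∑ i, m i = k → ∀ r, e r * F m =
    ∑ I ∈ (Finset.powersetCard r Finset.univ).filter (fun I => Addable m (indic I)),
      F (addBoxes m (indic I))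

theorem isStrip_iff {m a : Fin n → ℕ} : IsStrip m a ↔ ∀ j, a j ≤ m (j - 1) := by
  refine ⟨fun h j => ?_, fun h i => ?_⟩
  · simpa using h (j - 1)
  · simpa using h (i + 1)

/-- The substitution `b = a + indic I` regroups pairs of strips by their total `b`, so that the
signs can be summed for fixed `b`. -/
theorem sum_add_indic (m : Fin n → ℕ) (F : (Fin n → ℕ) → ℂ) {r : ℕ} (I : Finset (Fin n)) :
    (if I.card ≤ r then ∑ a ∈ (Finset.piAntidiag Finset.univ (r - I.card)).filter (IsStrip m),
      if Addable m (a + indic I) then F (addBoxes m (a + indic I)) else 0 else 0)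
    = ∑ b ∈ (Finset.piAntidiag Finset.univ r).filter (Addable m),
      if (∀ j, indic I j ≤ b j ∧ b j - indic I j ≤ m (j - 1)) then F (addBoxes m b) else 0 := by
  simp only [← Finset.sum_filter, Finset.filter_filter]
  by_cases hI : I.card ≤ r
  · rw [if_pos hI]
    refine Finset.sum_bij' (fun a _ => a + indic I) (fun b _ => b - indic I) ?_ ?_ ?_ ?_ ?_
    · intro a ha
      simp only [Finset.mem_filter, Finset.mem_piAntidiag, isStrip_iff, Pi.add_apply,
        Finset.sum_add_distrib, sum_indic] at ha ⊢
      refine ⟨⟨?_, by simp⟩, ha.2.2, fun j => ?_⟩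
      · have h1 : ∑ j, a j = r - I.card := ha.1.1
        omega
      have := ha.2.1 j
      omega
    · intro b hb
      simp only [Finset.mem_filter, Finset.mem_piAntidiag, isStrip_iff, Pi.sub_apply] at hb ⊢
      have hle : indic I ≤ b := fun j => (hb.2.2 j).1
      have h2 : ∑ j, (b j - indic I j) + I.card = r := by
        rw [← sum_indic, ← Finset.sum_add_distrib, ← hb.1.1]
        exact Finset.sum_congr rfl fun j _ => Nat.sub_add_cancel (hle j)
      refine ⟨⟨by omega, by simp⟩, fun j => (hb.2.2 j).2, ?_⟩
      rw [tsub_add_cancel_of_le hle]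
      exact hb.2.1
    · intro a _
      exact add_tsub_cancel_right a _
    · intro b hb
      simp only [Finset.mem_filter] at hb
      exact tsub_add_cancel_of_le fun j => (hb.2.2 j).1
    · intro a _
      rfl
  · rw [if_neg hI]
    symm
    apply Finset.sum_eq_zero
    intro b hb
    simp only [Finset.mem_filter, Finset.mem_piAntidiag] at hb
    have : ∑ j, indic I j ≤ ∑ j, b j := Finset.sum_le_sum fun j _ => (hb.2.2 j).1
    rw [sum_indic, hb.1.1] at this
    exact absurd this hI

/-- This is the analogue of ∑ (-1)^i e_i h_{r-i} = 0. The bound `r < k + n` excludes the one total,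
`b j = m (j - 1) + 1` for all `j`, at which the signs need not cancel. -/
theorem VerticalPieri.alternating_sum {k : ℕ} {e : ℕ → ℂ} {F : (Fin n → ℕ) → ℂ}
    (hF : VerticalPieri k e F) {m : Fin n → ℕ} (hm : ∑ i, m i = k) {r : ℕ} (h0 : 0 < r)
    (hr : r < k + n) :
    ∑ i ∈ Finset.range (n + 1), (-1) ^ i * e i * (if i ≤ r then stripSum F (r - i) m else 0)
      = 0 := by
  have h1 : ∀ i, (-1) ^ i * e i * (if i ≤ r then stripSum F (r - i) m else 0)
      = ∑ I ∈ Finset.powersetCard i Finset.univ,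
        ∑ b ∈ (Finset.piAntidiag Finset.univ r).filter (Addable m),
          (if (∀ j, indic I j ≤ b j ∧ b j - indic I j ≤ m (j - 1)) then (-1) ^ I.card else 0) *
            F (addBoxes m b) := by
    intro i
    have h2 : ∀ I ∈ Finset.powersetCard i (Finset.univ : Finset (Fin n)),
        ∑ b ∈ (Finset.piAntidiag Finset.univ r).filter (Addable m),
          (if (∀ j, indic I j ≤ b j ∧ b j - indic I j ≤ m (j - 1)) then (-1) ^ I.card else 0) *
            F (addBoxes m b) = (-1) ^ i * (if i ≤ r then
              ∑ a ∈ (Finset.piAntidiag Finset.univ (r - i)).filter (IsStrip m),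
              if Addable m (a + indic I) then F (addBoxes m (a + indic I)) else 0 else 0) := by
      intro I hI
      have hc := (Finset.mem_powersetCard.1 hI).2
      subst hc
      rw [sum_add_indic, Finset.mul_sum]
      refine Finset.sum_congr rfl fun b _ => ?_
      split_ifs <;> simp
    rw [Finset.sum_congr rfl h2, ← Finset.mul_sum, mul_assoc]
    congr 1
    split_ifs
    · rw [stripSum, Finset.mul_sum, Finset.sum_comm]
      refine Finset.sum_congr rfl fun a ha => ?_
      have ha' := (Finset.mem_filter.1 ha).2.addable
      rw [hF _ ((sum_addBoxes ha').trans hm), Finset.sum_filter]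
      refine Finset.sum_congr rfl fun I _ => ?_
      rw [addBoxes_addBoxes ha']
      exact if_congr (addable_addBoxes ha') rfl rfl
    · simp
  rw [Finset.sum_congr rfl fun i _ => h1 i]
  have h3 := Finset.sum_powerset (Finset.univ : Finset (Fin n)) (fun I =>
    ∑ b ∈ (Finset.piAntidiag Finset.univ r).filter (Addable m),
          (if (∀ j, indic I j ≤ b j ∧ b j - indic I j ≤ m (j - 1)) then (-1 : ℂ) ^ I.card else 0) *
            F (addBoxes m b))
  rw [Finset.card_univ, Fintype.card_fin] at h3
  rw [← h3, Finset.sum_comm]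
  refine Finset.sum_eq_zero fun b hb => ?_
  simp only [Finset.mem_filter, Finset.mem_piAntidiag] at hb
  have h4 : ∑ i, b i = r := hb.1.1
  rw [← Finset.sum_mul, signed_sum_eq_zero hb.2 (by omega) (by omega), zero_mul]

/-- The Pieri rule for horizontal strips follows from the rule for vertical strips. -/
theorem VerticalPieri.stripSum_mul {k : ℕ} {e : ℕ → ℂ} {F : (Fin n → ℕ) → ℂ}
    (hF : VerticalPieri k e F) (he : e 0 = 1) {m l : Fin n → ℕ} (hm : ∑ i, m i = k)
    (hl : ∑ i, l i = k) (r : ℕ) (hr : r < k + n) :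
    stripSum F r m * F l = stripSum F r l * F m := by
  induction r using Nat.strong_induction_on with
  | _ r ih =>
    rcases Nat.eq_zero_or_pos r with rfl | h0
    · have hz : ∀ m : Fin n → ℕ, stripSum F 0 m = F m := by
        intro m
        have : (Finset.piAntidiag (Finset.univ : Finset (Fin n)) 0).filter (IsStrip m) = {0} := by
          rw [Finset.piAntidiag_zero, Finset.filter_singleton, if_pos]
          exact fun i => Nat.zero_le _
        rw [stripSum, this, Finset.sum_singleton, addBoxes_zero]
      rw [hz, hz, mul_comm]
    -- The recursion expresses the strip sum by shorter ones with coefficients that do not depend on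
    -- `m`, so proportionality to `F` is inherited.
    · have key : ∀ m : Fin n → ℕ, ∑ i, m i = k → stripSum F r m =
          -∑ i ∈ Finset.range n, (-1) ^ (i + 1) * e (i + 1) *
            (if i + 1 ≤ r then stripSum F (r - (i + 1)) m else 0) := by
        intro m hm
        have := hF.alternating_sum hm h0 hr
        rw [Finset.sum_range_succ', he, if_pos (Nat.zero_le r)] at this
        simp only [pow_zero, one_mul, Nat.sub_zero] at this
        linear_combination this
      rw [key m hm, key l hl, neg_mul, neg_mul, Finset.sum_mul, Finset.sum_mul]
      congr 1
      refine Finset.sum_congr rfl fun i _ => ?_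
      split_ifs
      · rw [mul_assoc, ih _ (by omega) (by omega), ← mul_assoc]
      · simp

end Cyclic

/-! ### Alternants and the cylindric Pieri rule for vertical strips. -/

section Alternant

variable {n : ℕ} [NeZero n]

/-- The part `λ_{i+1} + n - i - 1` of the partition with the labels `m`, shifted by the staircase. -/
def exponent (m : Fin n → ℕ) (i : Fin n) : ℕ :=
  (∑ j : Fin n with i.1 ≤ j.1 ∧ j.1 + 1 < n, m j) + (n - 1 - i.1)

theorem exponent_of_lt (m : Fin n → ℕ) {i : Fin n} (h : i.1 + 1 < n) :
    exponent m i = exponent m (i + 1) + m i + 1 := by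
  have h1 : (Finset.univ.filter fun j : Fin n => i.1 ≤ j.1 ∧ j.1 + 1 < n)
      = insert i (Finset.univ.filter fun j : Fin n => (i + 1).1 ≤ j.1 ∧ j.1 + 1 < n) := by
    ext j
    simp only [Finset.mem_filter, Finset.mem_univ, true_and, Finset.mem_insert, Fin.ext_iff,
      val_add_one h]
    omega
  rw [exponent, exponent, h1, Finset.sum_insert (by simp [val_add_one h]), val_add_one h]
  omega

theorem exponent_nodeN (m : Fin n → ℕ) : exponent m (nodeN n) = 0 := by
  rw [exponent, Finset.sum_eq_zero]
  · simp [nodeN]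
  · intro j hj
    have h1 := (Finset.mem_filter.1 hj).2
    simp only [nodeN] at h1
    omega

theorem exponent_zero (m : Fin n → ℕ) :
    exponent m 0 + m (nodeN n) + 1 = ∑ i, m i + n := by
  have h1 : (Finset.univ : Finset (Fin n))
      = insert (nodeN n) (Finset.univ.filter fun j : Fin n => (0 : Fin n).1 ≤ j.1 ∧ j.1 + 1 < n) := by
    ext j
    rw [Finset.mem_insert, Finset.mem_filter, eq_nodeN_iff, Fin.val_zero]
    simp only [Finset.mem_univ, true_and, true_iff]
    omega
  rw [h1, Finset.sum_insert, exponent, Fin.val_zero]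
  · have := NeZero.pos n
    omega
  · have := NeZero.pos n
    simp only [Finset.mem_filter, nodeN]
    omega

/-- Downward induction over the nodes of the finite Dynkin diagram. -/
theorem node_induction {p : Fin n → Prop} (h0 : p (nodeN n))
    (h : ∀ i : Fin n, i.1 + 1 < n → p (i + 1) → p i) (i : Fin n) : p i := by
  obtain ⟨d, hd⟩ : ∃ d, i.1 + 1 + d = n := ⟨n - (i.1 + 1), by have := i.2; omega⟩
  induction d generalizing i with
  | zero => rwa [eq_nodeN_iff.2 (by omega : ¬ i.1 + 1 < n)]
  | succ d ih => exact h i (by omega) (ih _ (by rw [val_add_one (by omega)]; omega))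

/-- Labels describe a partition only up to full columns. Boxes in the last row therefore appear as a
uniform shift of all exponents, which `det_pow_add` removes. -/
theorem exponent_addBoxes {m b : Fin n → ℕ} (h : Addable m b) (i : Fin n) :
    exponent (addBoxes m b) i + b (nodeN n) = exponent m i + b i := by
  induction i using node_induction with
  | h0 => rw [exponent_nodeN, exponent_nodeN]
  | h i hi ih =>
    rw [exponent_of_lt _ hi, exponent_of_lt _ hi]
    have := (addBoxes_eq_iff h).1 rfl i
    omega

/-- The alternant of the points `X` at the strictly decreasing exponents of the labels `m`. -/
noncomputable def alternant (X : Fin n → ℂ) (m : Fin n → ℕ) : ℂ :=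
  (Matrix.of fun i j => X i ^ exponent m j).det

theorem alternant_addBoxes {X : Fin n → ℂ} (hX : ∏ i, X i = 1) {m b : Fin n → ℕ}
    (h : Addable m b) : (Matrix.of fun i j => X i ^ (exponent m j + b j)).det
      = alternant X (addBoxes m b) := by
  simp only [← exponent_addBoxes h]
  exact det_pow_add X hX _ _

/-- Addability fails only where `m i = 0` and row `i + 1` receives a box but row `i` does not. The
columns `i` and `i + 1` are then equal, or proportional if `i` is the affine node; this is where the
common power `z` enters. -/
theorem det_eq_zero_of_not_addable (hn : 2 ≤ n) {X : Fin n → ℂ} {k : ℕ} {z : ℂ}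
    (hz : ∀ i, X i ^ (k + n) = z) {m : Fin n → ℕ} (hm : ∑ i, m i = k) {I : Finset (Fin n)}
    (h : ¬ Addable m (indic I)) :
    (Matrix.of fun i j => X i ^ (exponent m j + indic I j)).det = 0 := by
  unfold Addable at h
  push Not at h
  obtain ⟨i, hi⟩ := h
  have h1 : i + 1 ∈ I := by
    by_contra hcon
    simp [indic, hcon] at hi
  have h2 : i ∉ I := by
    intro hcon
    simp [indic, hcon, h1] at hi
  have h3 : m i = 0 := by
    simp [indic, h1, h2] at hi
    exact hi
  by_cases hin : i.1 + 1 < n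
  · refine Matrix.det_zero_of_column_eq (i := i) (j := i + 1) ?_ fun a => ?_
    · intro hcon
      have := congrArg Fin.val hcon
      rw [val_add_one hin] at this
      omega
    · simp only [Matrix.of_apply, indic, h1, h2, if_true, if_false, exponent_of_lt m hin, h3]
  · have hi0 := eq_nodeN_iff.2 hin
    subst hi0
    rw [nodeN_add_one] at h1
    have h4 := exponent_zero m
    rw [h3, hm] at h4
    have hne : (0 : Fin n) ≠ nodeN n := by
      rw [Ne, eq_nodeN_iff, Fin.val_zero]
      omega
    -- The first exponent is now k + n and the last is 0, so the first column is `z` times the last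
    -- one, and this vector lies in the kernel.
    refine Matrix.exists_mulVec_eq_zero_iff.1
      ⟨Pi.single 0 1 - Pi.single (nodeN n) z, fun hcon => ?_, ?_⟩
    · have := congrFun hcon 0
      simp [hne] at this
    · ext a
      have h5 : exponent m 0 + 1 = k + n := by omega
      simp [Matrix.mulVec_sub, indic, h1, h2, exponent_nodeN, h5, hz]

theorem verticalPieri_alternant (hn : 2 ≤ n) {X : Fin n → ℂ} (hX : ∏ i, X i = 1) {k : ℕ} {z : ℂ}
    (hz : ∀ i, X i ^ (k + n) = z) : VerticalPieri k (elem X) (alternant X) := by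
  intro m hm r
  rw [alternant, elem_mul_det, Finset.sum_filter]
  refine Finset.sum_congr rfl fun I _ => ?_
  split_ifs with h
  · exact alternant_addBoxes hX h
  · exact det_eq_zero_of_not_addable hn hz hm h

end Alternant

/-! ### The modular matrix as a matrix of alternants, its invertibility, and the Verlinde sum. -/

section ModularMatrix

variable {n k : ℕ}

/-- The coordinates of the finite part of a weight, shifted by the Weyl vector. -/
noncomputable def coord (sig : Weight n k) (i : Fin n) : ℝ := finitePart sig i + weylVector n i

/-- The mean value of the exponents of a weight. -/
noncomputable def center (sig : Weight n k) : ℝ :=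
  (∑ j : Fin n, (part sig j.1 : ℝ)) / n + ((n : ℝ) - 1) / 2

theorem coord_eq (sig : Weight n k) (i : Fin n) : coord sig i = exponent sig.1 i - center sig := by
  have h1 : ((n - 1 - i.1 : ℕ) : ℝ) = (n : ℝ) - 1 - i.1 := by
    have := i.2
    rw [Nat.cast_sub (by omega), Nat.cast_sub (by omega), Nat.cast_one]
  have h2 : ((exponent sig.1 i : ℕ) : ℝ) = part sig i.1 + ((n : ℝ) - 1 - i.1) := by
    rw [← h1, ← Nat.cast_add]
    rfl
  rw [h2, coord, finitePart, weylVector, center]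
  ring

theorem exponent_strictAnti (sig : Weight n k) : StrictAnti (exponent sig.1) := by
  intro i j hij
  have h1 : part sig j.1 ≤ part sig i.1 := part_anti sig hij.le
  have h2 : i.1 < j.1 := hij
  have h3 := j.2
  change part sig j.1 + (n - 1 - j.1) < part sig i.1 + (n - 1 - i.1)
  omega

theorem coord_strictAnti (sig : Weight n k) : StrictAnti (coord sig) := by
  intro i j hij
  rw [coord_eq, coord_eq]
  have : (exponent sig.1 j : ℝ) < exponent sig.1 i := by exact_mod_cast exponent_strictAnti sig hij
  linarith

/-- The points at which the characters are evaluated. -/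
noncomputable def points (sig : Weight n k) (i : Fin n) : ℂ :=
  Complex.exp (-(2 * Real.pi * Complex.I / ((k : ℂ) + n)) * (coord sig i : ℝ))

/-- The scalar in front of the alternating sum. -/
noncomputable def prefactor (n k : ℕ) : ℂ :=
  Complex.exp (Complex.I * Real.pi * n * (n - 1) / 4)
        / ((Real.sqrt ((n : ℝ) * ((k : ℝ) + n) ^ (n - 1)) : ℝ) : ℂ)

theorem modularS_symm (lam sig : Weight n k) : modularS n k lam sig = modularS n k sig lam := by
  simp only [modularS, Matrix.of_apply]
  congr 1
  rw [← Equiv.sum_comp (Equiv.inv (Equiv.Perm (Fin n)))]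
  refine Finset.sum_congr rfl fun w _ => ?_
  rw [Equiv.inv_apply, Equiv.Perm.sign_inv, inv_inv, ← Equiv.sum_comp w⁻¹]
  congr 4
  refine Finset.sum_congr rfl fun i _ => ?_
  rw [show w (w⁻¹ i) = i from w.apply_symm_apply i]
  ring

variable [NeZero n]

theorem sum_coord (sig : Weight n k) : ∑ i, coord sig i = 0 := by
  have hn : (n : ℝ) ≠ 0 := by exact_mod_cast NeZero.ne n
  have h1 : ∑ i : Fin n, (i.1 : ℝ) = n * ((n : ℝ) - 1) / 2 := by
    have h2 := Finset.sum_range_id_mul_two n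
    have h3 : ((∑ i ∈ Finset.range n, i : ℕ) : ℝ) * 2 = n * ((n : ℝ) - 1) := by
      rw [← Nat.cast_pred (NeZero.pos n)]
      exact_mod_cast h2
    rw [Fin.sum_univ_eq_sum_range (fun i => (i : ℝ)) n]
    push_cast at h3
    linarith
  simp only [coord, finitePart, weylVector, Finset.sum_add_distrib, Finset.sum_sub_distrib, h1,
    Finset.sum_const, Finset.card_univ, Fintype.card_fin, nsmul_eq_mul]
  field_simp
  ring

/-- The shifted weight lies inside the fundamental alcove. This makes the points distinct and lets
them determine the weight. -/
theorem coord_sub_lt (sig : Weight n k) (i j : Fin n) : coord sig i - coord sig j < (k : ℝ) + n := by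
  have h1 : exponent sig.1 i ≤ exponent sig.1 0 :=
    (exponent_strictAnti sig).antitone (Fin.zero_le i)
  have h2 := exponent_zero sig.1
  rw [sig.2] at h2
  have h3 : exponent sig.1 i < k + n + exponent sig.1 j := by omega
  have h4 : (exponent sig.1 i : ℝ) < k + n + exponent sig.1 j := by exact_mod_cast h3
  rw [coord_eq, coord_eq]
  linarith

theorem height_pos (n k : ℕ) [NeZero n] : 0 < (k : ℝ) + n := by
  have : 0 < (n : ℝ) := by exact_mod_cast NeZero.pos n
  positivity

theorem height_ne_zero (n k : ℕ) [NeZero n] : (k : ℂ) + n ≠ 0 := by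
  exact_mod_cast (height_pos n k).ne'

theorem prefactor_ne_zero : prefactor n k ≠ 0 := by
  have h0 : 0 < (n : ℝ) := by exact_mod_cast NeZero.pos n
  have h1 := height_pos n k
  refine div_ne_zero (Complex.exp_ne_zero _) ?_
  exact_mod_cast (Real.sqrt_pos.2 (mul_pos h0 (pow_pos h1 _))).ne'

/-- The coordinates of `sig` sum to 0, so the shift by `center lam` drops out and only the integer
exponents of `lam` remain. -/
theorem modularS_eq (lam sig : Weight n k) :
    modularS n k lam sig = prefactor n k * alternant (points sig) lam.1 := by
  rw [modularS, Matrix.of_apply, alternant, Matrix.det_apply', prefactor]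
  congr 1
  refine Finset.sum_congr rfl fun w _ => ?_
  congr 1
  have h1 : ∑ i : Fin n, (finitePart sig i + weylVector n i) *
      (finitePart lam (w⁻¹ i) + weylVector n (w⁻¹ i))
        = ∑ i, coord sig (w i) * exponent lam.1 i := by
    calc _ = ∑ i, coord sig i * (exponent lam.1 (w⁻¹ i) - center lam) := by
          refine Finset.sum_congr rfl fun i _ => ?_
          rw [← coord_eq]
          rfl
      _ = ∑ i, coord sig i * exponent lam.1 (w⁻¹ i) := by
          simp only [mul_sub, Finset.sum_sub_distrib, ← Finset.sum_mul, sum_coord, zero_mul,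
            sub_zero]
      _ = _ := by
          rw [← Equiv.sum_comp w]
          simp
  rw [h1, Complex.ofReal_sum, Finset.mul_sum, Complex.exp_sum]
  refine Finset.prod_congr rfl fun i _ => ?_
  rw [Matrix.of_apply, points, ← Complex.exp_nat_mul]
  congr 1
  push_cast
  ring

theorem prod_points (sig : Weight n k) : ∏ i, points sig i = 1 := by
  simp only [points]
  rw [← Complex.exp_sum, ← Finset.mul_sum, ← Complex.ofReal_sum, sum_coord]
  simp

/-- The coordinates of `sig` are congruent modulo 1, whence the power does not depend on `i`. -/
theorem points_pow (sig : Weight n k) (i : Fin n) :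
    points sig i ^ (k + n) = Complex.exp (2 * Real.pi * Complex.I * center sig) := by
  rw [points, ← Complex.exp_nat_mul, coord_eq, Complex.exp_eq_exp_iff_exists_int]
  refine ⟨-(exponent sig.1 i : ℤ), ?_⟩
  have := height_ne_zero n k
  push_cast
  field_simp
  ring

theorem points_eq_iff {sig tau : Weight n k} {i j : Fin n} :
    points sig i = points tau j ↔ ∃ t : ℤ, coord sig i = coord tau j + ((k : ℝ) + n) * t := by
  have h1 := height_ne_zero n k
  have h2 := Complex.two_pi_I_ne_zero
  have h3 : ∀ t : ℤ, (coord sig i = coord tau j + ((k : ℝ) + n) * t) ↔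
      ((coord sig i : ℂ) = coord tau j + ((k : ℂ) + n) * t) := by
    intro t
    rw [← Complex.ofReal_inj]
    push_cast
    rfl
  rw [points, points, Complex.exp_eq_exp_iff_exists_int]
  simp only [h3]
  constructor
  · rintro ⟨t, ht⟩
    refine ⟨-t, mul_left_cancel₀ h2 ?_⟩
    field_simp at ht
    push_cast
    linear_combination (-(2 * Real.pi * Complex.I)) * ht
  · rintro ⟨t, ht⟩
    refine ⟨-t, ?_⟩
    rw [ht]
    push_cast
    field_simp
    ring

theorem eq_zero_of_coord_eq_add {sig : Weight n k} {i j : Fin n} {t : ℤ}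
    (h : coord sig i = coord sig j + ((k : ℝ) + n) * t) : t = 0 := by
  have h0 := height_pos n k
  have h1 := coord_sub_lt sig i j
  have h2 := coord_sub_lt sig j i
  have h3 : (t : ℝ) < 1 := by
    by_contra hcon
    nlinarith
  have h4 : (-1 : ℝ) < t := by
    by_contra hcon
    nlinarith
  have h5 : t < 1 := by exact_mod_cast h3
  have h6 : -1 < t := by exact_mod_cast h4
  omega

theorem points_injective (sig : Weight n k) : Function.Injective (points sig) := by
  intro i j h
  obtain ⟨t, ht⟩ := points_eq_iff.1 h
  rw [eq_zero_of_coord_eq_add ht] at ht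
  exact (coord_strictAnti sig).injective (by simpa using ht)

theorem coord_injective : Function.Injective (coord : Weight n k → Fin n → ℝ) := by
  intro sig tau h
  -- Differences of coordinates eliminate the two unknown centers; the last exponent is 0 for both
  -- weights.
  have h1 : ∀ i j, exponent sig.1 i + exponent tau.1 j = exponent tau.1 i + exponent sig.1 j := by
    intro i j
    have h2 := congrFun h i
    have h3 := congrFun h j
    rw [coord_eq, coord_eq] at h2 h3
    have : (exponent sig.1 i : ℝ) + exponent tau.1 j = exponent tau.1 i + exponent sig.1 j := by
      linarith
    exact_mod_cast this
  have h2 : ∀ i, exponent sig.1 i = exponent tau.1 i := by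
    intro i
    have := h1 i (nodeN n)
    rwa [exponent_nodeN, exponent_nodeN, add_zero, add_zero] at this
  apply Subtype.ext
  funext i
  by_cases hi : i.1 + 1 < n
  · have h3 := exponent_of_lt sig.1 hi
    have h4 := exponent_of_lt tau.1 hi
    rw [h2, h2] at h3
    omega
  · rw [← eq_nodeN_iff] at hi
    subst hi
    have h3 := exponent_zero sig.1
    have h4 := exponent_zero tau.1
    rw [sig.2, h2] at h3
    rw [tau.2] at h4
    omega

/-- The elementary symmetric polynomials separate the weights. -/
theorem eq_of_elem_points_eq {sig tau : Weight n k}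
    (h : ∀ r, elem (points sig) r = elem (points tau) r) : sig = tau := by
  choose w hw using exists_eq_of_elem_eq h
  have hinj : Function.Injective w := fun i j hij =>
    points_injective tau (by rw [← hw i, ← hw j, hij])
  have hbij := Finite.injective_iff_bijective.1 hinj
  choose t ht using fun j => points_eq_iff.1 (hw j)
  have h0 := height_pos n k
  have hsum : ∑ j, t j = 0 := by
    have h1 : ∑ j, coord sig (w j) = 0 := by
      rw [← sum_coord sig]
      exact Equiv.sum_comp (Equiv.ofBijective w hbij) (coord sig)
    rw [Finset.sum_congr rfl fun j _ => ht j, Finset.sum_add_distrib, sum_coord, zero_add,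
      ← Finset.mul_sum] at h1
    exact_mod_cast (mul_eq_zero.1 h1).resolve_left h0.ne'
  -- The shifts `t` sum to 0. If they were not all 0, one would be positive and one negative, and
  -- the two coordinates of `sig` would differ by more than k + n.
  have hz : ∀ j, t j = 0 := by
    by_contra! hcon
    obtain ⟨a, ha⟩ := hcon
    obtain ⟨i, hi⟩ : ∃ i, 0 < t i := by
      by_contra! hle
      exact ha ((Finset.sum_eq_zero_iff_of_nonpos fun j _ => hle j).1 hsum a (Finset.mem_univ a))
    obtain ⟨j, hj⟩ : ∃ j, t j < 0 := by
      by_contra! hle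
      exact ha ((Finset.sum_eq_zero_iff_of_nonneg fun j _ => hle j).1 hsum a (Finset.mem_univ a))
    have h1 := coord_sub_lt sig (w i) (w j)
    have h2 := coord_sub_lt tau j i
    have h3 : (1 : ℝ) ≤ t i := by exact_mod_cast hi
    have h4 : (t j : ℝ) ≤ -1 := by exact_mod_cast (by omega : t j ≤ -1)
    rw [ht, ht] at h1
    nlinarith
  have hcomp : coord sig ∘ w = coord tau := by
    funext j
    rw [Function.comp_apply, ht, hz]
    simp
  apply coord_injective
  refine ((coord_strictAnti sig).range_inj (coord_strictAnti tau)).1 ?_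
  rw [← hcomp, hbij.surjective.range_comp]

theorem emptyWeight_apply {i : Fin n} (hi : i.1 + 1 < n) : (emptyWeight n k).1 i = 0 := by
  have h1 : ∀ i, (rect 0 0).rowLen i = 0 := by
    intro i
    by_contra h
    have := mem_rect.1 (YoungDiagram.mem_iff_lt_rowLen.2 (Nat.pos_of_ne_zero h))
    simp at this
  simp [emptyWeight, hat, hi, h1]

theorem emptyWeight_nodeN : (emptyWeight n k).1 (nodeN n) = k := by
  have h := (emptyWeight n k).2
  rwa [Finset.sum_eq_single (nodeN n) (fun i _ hi => emptyWeight_apply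
    (by rwa [Ne, eq_nodeN_iff, not_not] at hi)) (by simp)] at h

theorem exponent_emptyWeight (i : Fin n) : exponent (emptyWeight n k).1 i = n - 1 - i.1 := by
  rw [exponent, Finset.sum_eq_zero, zero_add]
  intro j hj
  exact emptyWeight_apply (Finset.mem_filter.1 hj).2.2

theorem alternant_emptyWeight_ne_zero (sig : Weight n k) :
    alternant (points sig) (emptyWeight n k).1 ≠ 0 := by
  have h1 : (Matrix.of fun i j => points sig i ^ exponent (emptyWeight n k).1 j)
      = (Matrix.vandermonde (points sig)).submatrix id Fin.revPerm := by
    ext i j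
    rw [Matrix.of_apply, exponent_emptyWeight, Matrix.submatrix_apply, Matrix.vandermonde_apply,
      Fin.revPerm_apply, Fin.val_rev, id, Nat.sub_sub, add_comm]
  rw [alternant, h1, Matrix.det_permute']
  refine mul_ne_zero ?_ (Matrix.det_vandermonde_ne_zero_iff.2 (points_injective sig))
  simp

theorem verticalPieri_points (hn : 2 ≤ n) (sig : Weight n k) :
    VerticalPieri k (elem (points sig)) (alternant (points sig)) :=
  verticalPieri_alternant hn (prod_points sig) (points_pow sig)

/-- A vector orthogonal to all alternants vanishes. -/
theorem eq_zero_of_alternant_orthogonal (hn : 2 ≤ n) {c : Weight n k → ℂ}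
    (hc : ∀ m : Fin n → ℕ, ∑ i, m i = k → ∑ sig, alternant (points sig) m * c sig = 0) :
    c = 0 := by
  funext tau
  have hsep : ∀ sig : Weight n k, ∃ r, sig ≠ tau → elem (points sig) r ≠ elem (points tau) r := by
    intro sig
    by_cases h : sig = tau
    · exact ⟨0, fun h' => absurd h h'⟩
    · by_contra! hcon
      exact h (eq_of_elem_points_eq fun r => (hcon r).2)
  choose r hr using hsep
  -- By the Pieri rule, orthogonality to all alternants survives multiplication of `c` by e_r -
  -- const. A product of such factors, taken over all weights other than `tau`, isolates `c tau`.
  have key : ∀ s : Finset (Weight n k), ∀ m : Fin n → ℕ, ∑ i, m i = k →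
      ∑ sig, alternant (points sig) m *
        ((∏ rho ∈ s, (elem (points sig) (r rho) - elem (points rho) (r rho))) * c sig) = 0 := by
    intro s
    induction s using Finset.induction_on with
    | empty => simpa using hc
    | insert a s ha ih =>
      intro m hm
      simp only [Finset.prod_insert ha]
      have h1 : ∀ sig : Weight n k, alternant (points sig) m *
          ((elem (points sig) (r a) - elem (points a) (r a)) *
            (∏ rho ∈ s, (elem (points sig) (r rho) - elem (points rho) (r rho))) * c sig)
          = ∑ I ∈ (Finset.powersetCard (r a) Finset.univ).filter (fun I => Addable m (indic I)),
            alternant (points sig) (addBoxes m (indic I)) *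
              ((∏ rho ∈ s, (elem (points sig) (r rho) - elem (points rho) (r rho))) * c sig)
          - elem (points a) (r a) * (alternant (points sig) m *
              ((∏ rho ∈ s, (elem (points sig) (r rho) - elem (points rho) (r rho))) * c sig)) := by
        intro sig
        rw [← Finset.sum_mul, ← verticalPieri_points hn sig m hm (r a)]
        ring
      rw [Finset.sum_congr rfl fun sig _ => h1 sig, Finset.sum_sub_distrib, ← Finset.mul_sum,
        ih m hm, mul_zero, sub_zero, Finset.sum_comm]
      refine Finset.sum_eq_zero fun I hI => ih _ ?_
      rw [sum_addBoxes (Finset.mem_filter.1 hI).2, hm]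
  have h2 := key (Finset.univ.erase tau) _ (emptyWeight n k).2
  rw [Finset.sum_eq_single tau] at h2
  · refine ((mul_eq_zero.1 ((mul_eq_zero.1 h2).resolve_left
      (alternant_emptyWeight_ne_zero tau))).resolve_left ?_)
    refine Finset.prod_ne_zero_iff.2 fun rho hrho => ?_
    exact sub_ne_zero.2 (hr rho (Finset.ne_of_mem_erase hrho)).symm
  · intro sig _ hsig
    rw [Finset.prod_eq_zero (Finset.mem_erase.2 ⟨hsig, Finset.mem_univ sig⟩) (sub_self _), zero_mul,
      mul_zero]
  · simp

theorem isUnit_det_modularS (hn : 2 ≤ n) : IsUnit (modularS n k).det := by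
  rw [isUnit_iff_ne_zero]
  intro h
  obtain ⟨c, hc0, hc⟩ := Matrix.exists_mulVec_eq_zero_iff.2 h
  refine hc0 (eq_zero_of_alternant_orthogonal hn fun m hm => ?_)
  have h1 := congrFun hc ⟨m, hm⟩
  simp only [Matrix.mulVec, dotProduct, modularS_eq, mul_assoc, ← Finset.mul_sum,
    Pi.zero_apply] at h1
  exact (mul_eq_zero.1 h1).resolve_left prefactor_ne_zero

/-- The Verlinde formula pairs a row of S with a row of its inverse; as S is symmetric, so is the
inverse, and this is an entry of the product. -/
theorem sum_modularS_mul_inv (hn : 2 ≤ n) (mu nu : Weight n k) :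
    ∑ sig, modularS n k mu sig * (modularS n k)⁻¹ nu sig = if mu = nu then 1 else 0 := by
  have h1 : (modularS n k).transpose = modularS n k := by
    ext lam sig
    exact modularS_symm sig lam
  have h2 : ∀ sig, (modularS n k)⁻¹ nu sig = (modularS n k)⁻¹ sig nu := by
    intro sig
    conv_lhs => rw [← h1, ← Matrix.transpose_nonsing_inv, Matrix.transpose_apply]
  simp only [h2]
  rw [← Matrix.mul_apply, Matrix.mul_nonsing_inv _ (isUnit_det_modularS hn), Matrix.one_apply]

/-- A product expansion of the alternants computes the fusion coefficients. -/
theorem fusionCoeff_eq_card (hn : 2 ≤ n) {ι : Type*} (T : Finset ι) (g : ι → Fin n → ℕ)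
    (hg : ∀ t ∈ T, ∑ i, g t i = k) (lam mu nu : Weight n k)
    (h : ∀ sig : Weight n k, alternant (points sig) lam.1 * alternant (points sig) mu.1 =
      alternant (points sig) (emptyWeight n k).1 * ∑ t ∈ T, alternant (points sig) (g t)) :
    fusionCoeff lam mu nu = (T.filter fun t => g t = nu.1).card := by
  have h1 : ∀ sig : Weight n k, modularS n k lam sig * modularS n k mu sig *
      (modularS n k)⁻¹ nu sig / modularS n k (emptyWeight n k) sig
      = ∑ t ∈ T.attach, modularS n k ⟨g t, hg t t.2⟩ sig * (modularS n k)⁻¹ nu sig := by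
    intro sig
    have h2 := alternant_emptyWeight_ne_zero sig
    have h3 := prefactor_ne_zero (n := n) (k := k)
    simp only [modularS_eq, ← Finset.sum_mul, ← Finset.mul_sum]
    rw [Finset.sum_attach T (fun t => alternant (points sig) (g t)),
      div_eq_iff (mul_ne_zero h3 h2)]
    linear_combination (prefactor n k ^ 2 * (modularS n k)⁻¹ nu sig) * h sig
  rw [fusionCoeff, Finset.sum_congr rfl fun sig _ => h1 sig, Finset.sum_comm,
    Finset.sum_congr rfl fun t _ => sum_modularS_mul_inv hn _ nu, Finset.card_filter]
  push_cast
  rw [← Finset.sum_attach T]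
  exact Finset.sum_congr rfl fun t _ => if_congr Subtype.ext_iff rfl rfl

end ModularMatrix

/-! ### Fusion with a column or a row as a count of cylindric strips. -/

section PieriCoefficients

variable {n k : ℕ}

theorem rowLen_eq {lam : YoungDiagram} {i c : ℕ} (h : ∀ j, (i, j) ∈ lam ↔ j < c) :
    lam.rowLen i = c := by
  have h1 : ∀ j, j < lam.rowLen i ↔ j < c := fun j => by
    rw [← YoungDiagram.mem_iff_lt_rowLen, h]
  exact le_antisymm (not_lt.1 fun hc => lt_irrefl _ ((h1 _).1 hc))
    (not_lt.1 fun hc => lt_irrefl _ ((h1 _).2 hc))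

theorem rowLen_rect (a b i : ℕ) : (rect a b).rowLen i = if i < a then b else 0 := by
  refine rowLen_eq fun j => ?_
  rw [mem_rect]
  split_ifs with h
  · simp [h]
  · simp [h]

variable [NeZero n]

theorem columnWeight_boxes {r : ℕ} (hr : r < n) (hk : r = 0 ∨ 0 < k) (i : Fin n) :
    (columnWeight n k r hr hk).1 i + indic (Finset.univ.filter fun j : Fin n => j.1 < r) (i + 1)
      = (emptyWeight n k).1 i + indic (Finset.univ.filter fun j : Fin n => j.1 < r) i := by
  simp only [indic, Finset.mem_filter, Finset.mem_univ, true_and, columnWeight, hat, rowLen_rect]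
  by_cases hi : i.1 + 1 < n
  · rw [val_add_one hi, emptyWeight_apply hi, if_pos hi]
    split_ifs <;> omega
  · rw [add_one_eq_zero hi, if_neg hi, eq_nodeN_iff.2 hi, emptyWeight_nodeN, Fin.val_zero]
    have : (nodeN n).1 = n - 1 := rfl
    split_ifs <;> omega

theorem rowWeight_boxes (hn : 2 ≤ n) {r : ℕ} (hr : r ≤ k) (i : Fin n) :
    (rowWeight n k r hn hr).1 i + Pi.single (M := fun _ => ℕ) (0 : Fin n) r (i + 1)
      = (emptyWeight n k).1 i + Pi.single (M := fun _ => ℕ) (0 : Fin n) r i := by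
  simp only [Pi.single_apply, rowWeight, hat, rowLen_rect]
  by_cases hi : i.1 + 1 < n
  · have h1 : i + 1 ≠ 0 := by
      rw [Ne, Fin.ext_iff, val_add_one hi]
      simp
    rw [emptyWeight_apply hi, if_pos hi, if_neg h1]
    simp only [Fin.ext_iff, Fin.val_zero]
    split_ifs <;> omega
  · rw [add_one_eq_zero hi, if_neg hi, eq_nodeN_iff.2 hi, emptyWeight_nodeN]
    simp only [Fin.ext_iff, Fin.val_zero]
    have : (nodeN n).1 = n - 1 := rfl
    split_ifs <;> omega

/-- All labels of the empty weight but the affine one are 0, so a box in row `i + 1` with `i` not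
the affine node needs a box in row `i`. -/
theorem eq_initial_of_addable_empty {I : Finset (Fin n)}
    (h : Addable (emptyWeight n k).1 (indic I)) :
    I = Finset.univ.filter fun j : Fin n => j.1 < I.card := by
  have hdown : ∀ d : ℕ, ∀ i : Fin n, i ∈ I → ∀ j : Fin n, j.1 + d = i.1 → j ∈ I := by
    intro d
    induction d with
    | zero =>
      intro i hi j hj
      rwa [Fin.ext (by omega : j.1 = i.1)]
    | succ d ih =>
      intro i hi j hj
      have h1 : j.1 + 1 < n := by have := i.2; omega
      have h2 := ih i hi (j + 1) (by rw [val_add_one h1]; omega)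
      have h3 := h j
      rw [emptyWeight_apply h1] at h3
      by_contra h4
      simp [indic, h2, h4] at h3
  refine Finset.eq_of_subset_of_card_le (fun i hi => ?_) ?_
  · have h1 : Finset.Iic i ⊆ I := fun j hj => by
      have h0 : j ≤ i := Finset.mem_Iic.1 hj
      have : j.1 ≤ i.1 := h0
      exact hdown (i.1 - j.1) i hi j (by omega)
    have h2 := Finset.card_le_card h1
    rw [Fin.card_Iic] at h2
    simp only [Finset.mem_filter, Finset.mem_univ, true_and]
    omega
  · rw [Fin.card_filter_val_lt]
    exact min_le_right _ _

open Classical in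
theorem fusionCoeff_columnWeight (hn : 2 ≤ n) {r : ℕ} (hr : r < n) (hk : r = 0 ∨ 0 < k)
    (mu nu : Weight n k) : fusionCoeff (columnWeight n k r hr hk) mu nu =
      if ∃ b : Fin n → ℕ, (∀ i, b i ≤ 1) ∧ ∑ i, b i = r ∧ ∀ i, nu.1 i + b (i + 1) = mu.1 i + b i
      then 1 else 0 := by
  set I0 : Finset (Fin n) := Finset.univ.filter fun j : Fin n => j.1 < r with hI0
  have hcol := columnWeight_boxes hr hk
  have hadd := addable_of_eq hcol
  have hcard : I0.card = r := by
    rw [hI0, Fin.card_filter_val_lt]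
    omega
  rw [fusionCoeff_eq_card hn
    ((Finset.powersetCard r Finset.univ).filter fun I => Addable mu.1 (indic I))
    (fun I => addBoxes mu.1 (indic I))
    (fun I hI => (sum_addBoxes (Finset.mem_filter.1 hI).2).trans mu.2)]
  · split_ifs with h
    · obtain ⟨b, hb1, hbr, hb⟩ := h
      obtain ⟨I, rfl⟩ := exists_eq_indic hb1
      rw [sum_indic] at hbr
      have hI := addable_of_eq hb
      rw [Nat.cast_eq_one, Finset.card_eq_one]
      refine ⟨I, Finset.eq_singleton_iff_unique_mem.2 ⟨?_, fun J hJ => ?_⟩⟩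
      · simp only [Finset.mem_filter, Finset.mem_powersetCard, Finset.subset_univ, true_and]
        exact ⟨⟨hbr, hI⟩, (addBoxes_eq_iff hI).2 hb⟩
      · simp only [Finset.mem_filter, Finset.mem_powersetCard, Finset.subset_univ, true_and] at hJ
        refine indic_injective (boxes_unique ((addBoxes_eq_iff hJ.1.2).1 hJ.2) hb ?_)
        rw [sum_indic, sum_indic, hJ.1.1, hbr]
    · rw [Nat.cast_eq_zero, Finset.card_eq_zero, Finset.filter_eq_empty_iff]
      intro I hI hnu
      simp only [Finset.mem_filter, Finset.mem_powersetCard, Finset.subset_univ, true_and] at hI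
      refine h ⟨indic I, fun i => ?_, by rw [sum_indic, hI.1], (addBoxes_eq_iff hI.2).1 hnu⟩
      unfold indic
      split_ifs <;> simp
  -- The Pieri rule at the empty weight has a single term, which identifies e_r times the empty
  -- alternant with the alternant of the column.
  · intro sig
    have h1 := verticalPieri_points hn sig _ (emptyWeight n k).2 r
    have h2 : (Finset.powersetCard r Finset.univ).filter
        (fun I => Addable (emptyWeight n k).1 (indic I)) = {I0} := by
      refine Finset.eq_singleton_iff_unique_mem.2 ⟨?_, fun J hJ => ?_⟩
      · simp only [Finset.mem_filter, Finset.mem_powersetCard, Finset.subset_univ, true_and]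
        exact ⟨hcard, hadd⟩
      · simp only [Finset.mem_filter, Finset.mem_powersetCard, Finset.subset_univ, true_and] at hJ
        have := eq_initial_of_addable_empty hJ.2
        rwa [hJ.1] at this
    rw [h2, Finset.sum_singleton, (addBoxes_eq_iff hadd).2 hcol] at h1
    rw [← h1, ← verticalPieri_points hn sig _ mu.2 r]
    ring

open Classical in
theorem fusionCoeff_rowWeight (hn : 2 ≤ n) {r : ℕ} (hr : r ≤ k)
    (mu nu : Weight n k) : fusionCoeff (rowWeight n k r hn hr) mu nu =
      if ∃ b : Fin n → ℕ, IsStrip mu.1 b ∧ ∑ i, b i = r ∧ ∀ i, nu.1 i + b (i + 1) = mu.1 i + b i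
      then 1 else 0 := by
  have hrow := rowWeight_boxes hn hr
  rw [fusionCoeff_eq_card hn
    ((Finset.piAntidiag Finset.univ r).filter (IsStrip mu.1))
    (fun b => addBoxes mu.1 b)
    (fun b hb => (sum_addBoxes (Finset.mem_filter.1 hb).2.addable).trans mu.2)]
  · split_ifs with h
    · obtain ⟨b, hb1, hbr, hb⟩ := h
      rw [Nat.cast_eq_one, Finset.card_eq_one]
      refine ⟨b, Finset.eq_singleton_iff_unique_mem.2 ⟨?_, fun a ha => ?_⟩⟩
      · simp only [Finset.mem_filter, Finset.mem_piAntidiag]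
        exact ⟨⟨⟨hbr, by simp⟩, hb1⟩, (addBoxes_eq_iff hb1.addable).2 hb⟩
      · simp only [Finset.mem_filter, Finset.mem_piAntidiag] at ha
        exact boxes_unique ((addBoxes_eq_iff ha.1.2.addable).1 ha.2) hb (ha.1.1.1.trans hbr.symm)
    · rw [Nat.cast_eq_zero, Finset.card_eq_zero, Finset.filter_eq_empty_iff]
      intro b hb hnu
      simp only [Finset.mem_filter, Finset.mem_piAntidiag] at hb
      exact h ⟨b, hb.2, hb.1.1, (addBoxes_eq_iff hb.2.addable).1 hnu⟩
  · intro sig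
    -- Comparing `mu` with the empty weight replaces a complete symmetric polynomial: the only strip
    -- on the empty weight is `r` boxes in the first row, which fit because its affine label is `k ≥
    -- r`.
    have h1 := (verticalPieri_points hn sig).stripSum_mul (elem_zero _) (emptyWeight n k).2 mu.2 r
      (by have := NeZero.pos n; omega)
    have h2 : (Finset.piAntidiag Finset.univ r).filter (IsStrip (emptyWeight n k).1)
        = {Pi.single (0 : Fin n) r} := by
      refine Finset.eq_singleton_iff_unique_mem.2 ⟨?_, fun b hb => ?_⟩
      · simp only [Finset.mem_filter, Finset.mem_piAntidiag]
        refine ⟨⟨Finset.sum_pi_single' 0 r Finset.univ |>.trans (by simp), by simp⟩, fun i => ?_⟩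
        rw [Pi.single_apply]
        split_ifs with hi
        · rw [add_one_eq_zero_iff.1 hi, emptyWeight_nodeN]
          exact hr
        · exact Nat.zero_le _
      · simp only [Finset.mem_filter, Finset.mem_piAntidiag] at hb
        have h3 : ∀ j, j ≠ 0 → b j = 0 := by
          intro j hj
          have h4 := hb.2 (j - 1)
          rw [sub_add_cancel, emptyWeight_apply] at h4
          · omega
          · by_contra hcon
            rw [← eq_nodeN_iff, ← add_one_eq_zero_iff, sub_add_cancel] at hcon
            exact hj hcon
        have h5 : b 0 = r := by
          rw [← hb.1.1]
          exact (Finset.sum_eq_single 0 (fun j _ hj => h3 j hj) (by simp)).symm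
        funext j
        rw [Pi.single_apply]
        split_ifs with hj
        · rw [hj, h5]
        · exact h3 j hj
    have h3 : stripSum (alternant (points sig)) r (emptyWeight n k).1
        = alternant (points sig) (rowWeight n k r hn hr).1 := by
      rw [stripSum, h2, Finset.sum_singleton, (addBoxes_eq_iff (addable_of_eq hrow)).2 hrow]
    rw [h3] at h1
    rw [h1, stripSum, mul_comm]

end PieriCoefficients

/-! ### Translation between Young diagrams and boxes added to labels. -/

section Diagrams

variable {n k : ℕ}

theorem rowLen_deleteColumns (lam : YoungDiagram) (i : ℕ) :
    (deleteColumns n lam).rowLen i = lam.rowLen i - lam.rowLen (n - 1) := by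
  refine rowLen_eq fun j => ?_
  rw [← YoungDiagram.mem_cells]
  simp only [deleteColumns, Finset.mem_filter, YoungDiagram.mem_cells,
    YoungDiagram.mem_iff_lt_rowLen]
  omega

theorem eq_iff_rowLen {lam mu : YoungDiagram} : lam = mu ↔ ∀ i, lam.rowLen i = mu.rowLen i := by
  refine ⟨fun h i => by rw [h], fun h => ?_⟩
  ext ⟨i, j⟩
  rw [YoungDiagram.mem_cells, YoungDiagram.mem_cells, YoungDiagram.mem_iff_lt_rowLen,
    YoungDiagram.mem_iff_lt_rowLen, h]

theorem le_iff_rowLen {lam mu : YoungDiagram} : mu ≤ lam ↔ ∀ i, mu.rowLen i ≤ lam.rowLen i := by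
  constructor
  · intro h i
    by_contra hcon
    have h1 : (i, lam.rowLen i) ∈ lam :=
      h (YoungDiagram.mem_iff_lt_rowLen.2 (not_le.1 hcon))
    exact lt_irrefl _ (YoungDiagram.mem_iff_lt_rowLen.1 h1)
  · rintro h ⟨i, j⟩ hij
    exact YoungDiagram.mem_iff_lt_rowLen.2 ((YoungDiagram.mem_iff_lt_rowLen.1 hij).trans_le (h i))

theorem represents_iff {lam : YoungDiagram} {nu : Weight n k} :
    Represents lam nu ↔ lam.rowLen n = 0 ∧ lam.rowLen 0 ≤ k ∧
      ∀ i, lam.rowLen i - lam.rowLen (n - 1) = part nu i := by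
  have h1 : lam.colLen 0 ≤ n ↔ lam.rowLen n = 0 := by
    rw [← not_lt, ← YoungDiagram.mem_iff_lt_colLen, YoungDiagram.mem_iff_lt_rowLen]
    omega
  rw [Represents, h1, eq_iff_rowLen]
  simp only [rowLen_deleteColumns, rowLen_diagram]

theorem mem_cells_sdiff {lam mu : YoungDiagram} {i j : ℕ} :
    (i, j) ∈ lam.cells \ mu.cells ↔ mu.rowLen i ≤ j ∧ j < lam.rowLen i := by
  rw [Finset.mem_sdiff, YoungDiagram.mem_cells, YoungDiagram.mem_cells,
    YoungDiagram.mem_iff_lt_rowLen, YoungDiagram.mem_iff_lt_rowLen]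
  omega

theorem card_cells_sdiff {lam mu : YoungDiagram} (h : lam.rowLen n = 0) :
    (lam.cells \ mu.cells).card = ∑ i : Fin n, (lam.rowLen i - mu.rowLen i) := by
  have h1 : ∀ i, n ≤ i → lam.rowLen i = 0 := fun i hi => by
    have := lam.rowLen_anti n i hi
    omega
  rw [Fin.sum_univ_eq_sum_range (fun i => lam.rowLen i - mu.rowLen i) n,
    Finset.card_eq_sum_card_fiberwise (f := Prod.fst) (t := Finset.range n)]
  · refine Finset.sum_congr rfl fun i _ => ?_
    have h2 : (lam.cells \ mu.cells).filter (fun c => c.1 = i)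
        = (Finset.Ico (mu.rowLen i) (lam.rowLen i)).map ⟨fun j => (i, j), fun a b hab => by
          simpa using hab⟩ := by
      ext ⟨a, b⟩
      rw [Finset.mem_filter, mem_cells_sdiff]
      rw [Finset.mem_map]
      constructor
      · rintro ⟨h3, rfl⟩
        exact ⟨b, Finset.mem_Ico.2 h3, rfl⟩
      · rintro ⟨c, h3, hc⟩
        obtain ⟨rfl, rfl⟩ := Prod.mk.inj hc
        exact ⟨Finset.mem_Ico.1 h3, rfl⟩
    rw [h2, Finset.card_map, Nat.card_Ico]
  · rintro ⟨i, j⟩ hij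
    have h2 := mem_cells_sdiff.1 hij
    have h3 := h1 i
    simp only [Finset.coe_range, Set.mem_Iio]
    omega

theorem isVerticalStrip_iff {r : ℕ} {lam mu : YoungDiagram} :
    IsVerticalStrip r lam mu ↔ mu ≤ lam ∧ (lam.cells \ mu.cells).card = r ∧
      ∀ i, lam.rowLen i ≤ mu.rowLen i + 1 := by
  refine and_congr_right fun _ => and_congr_right fun _ => ⟨fun h i => ?_, ?_⟩
  · by_contra hcon
    have := h (i, mu.rowLen i) (mem_cells_sdiff.2 (by omega)) (i, mu.rowLen i + 1)
      (mem_cells_sdiff.2 (by omega)) rfl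
    simp at this
  · rintro h ⟨i, j⟩ hc ⟨i', j'⟩ hd hcd
    obtain rfl : i = i' := hcd
    have h1 := mem_cells_sdiff.1 hc
    have h2 := mem_cells_sdiff.1 hd
    have h3 := h i
    rw [(by omega : j = j')]

theorem isHorizontalStrip_iff {r : ℕ} {lam mu : YoungDiagram} :
    IsHorizontalStrip r lam mu ↔ mu ≤ lam ∧ (lam.cells \ mu.cells).card = r ∧
      ∀ i, lam.rowLen (i + 1) ≤ mu.rowLen i := by
  refine and_congr_right fun _ => and_congr_right fun _ => ⟨fun h i => ?_, ?_⟩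
  · by_contra hcon
    have h1 := mu.rowLen_anti i (i + 1) (by omega)
    have h2 := lam.rowLen_anti i (i + 1) (by omega)
    have := h (i, mu.rowLen i) (mem_cells_sdiff.2 (by omega)) (i + 1, mu.rowLen i)
      (mem_cells_sdiff.2 (by omega)) rfl
    simp at this
  · rintro h ⟨i, j⟩ hc ⟨i', j'⟩ hd hcd
    obtain rfl : j = j' := hcd
    have key : ∀ a b : ℕ, (a, j) ∈ lam.cells \ mu.cells → (b, j) ∈ lam.cells \ mu.cells →
        ¬ a < b := by
      intro a b ha hb hab
      have h1 := mem_cells_sdiff.1 ha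
      have h2 := mem_cells_sdiff.1 hb
      have h3 := h a
      have h4 := lam.rowLen_anti (a + 1) b hab
      omega
    rw [le_antisymm (not_lt.1 (key _ _ hd hc)) (not_lt.1 (key _ _ hc hd))]

/-- The Young diagram with the row lengths `f`. -/
def ofRows (n : ℕ) (f : ℕ → ℕ) (hf : Antitone f) : YoungDiagram where
  cells := (Finset.range n ×ˢ Finset.range (f 0)).filter fun c => c.2 < f c.1
  isLowerSet := by
    rintro ⟨i, j⟩ ⟨i', j'⟩ hle hmem
    simp only [Prod.mk_le_mk] at hle
    simp only [Finset.coe_filter, Finset.mem_product, Finset.mem_range, Set.mem_ofPred_eq]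
      at hmem ⊢
    have h1 := hf hle.1
    omega

theorem rowLen_ofRows {f : ℕ → ℕ} (hf : Antitone f) (h0 : f n = 0) (i : ℕ) :
    (ofRows n f hf).rowLen i = f i := by
  refine rowLen_eq fun j => ?_
  rw [← YoungDiagram.mem_cells]
  simp only [ofRows, Finset.mem_filter, Finset.mem_product, Finset.mem_range]
  have h1 := hf (Nat.zero_le i)
  have h2 : n ≤ i → f i = 0 := fun hi => by
    have := hf hi
    omega
  omega

theorem part_eq_zero (mu : Weight n k) {i : ℕ} (hi : n ≤ i + 1) : part mu i = 0 := by
  apply Finset.sum_eq_zero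
  intro a ha
  simp only [Finset.mem_filter, Finset.mem_univ, true_and] at ha
  omega

theorem exponent_eq_part (mu : Weight n k) (i : Fin n) :
    exponent mu.1 i = part mu i.1 + (n - 1 - i.1) := rfl

theorem phiStar_apply (i j : Fin n) (m : Weight n k) :
    (phiStar i m).1 j = m.1 j + if j = i then 1 else 0 := by
  simp only [phiStar]
  split_ifs <;> rfl

theorem phi_apply_add (i j : Fin n) (m : Weight n k) (h : 0 < m.1 i) :
    (phi i m h).1 j + (if j = i then 1 else 0) = m.1 j := by
  simp only [phi]
  split_ifs with hj
  · subst hj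
    omega
  · rfl

variable [NeZero n]

theorem part_of_lt (mu : Weight n k) {i : Fin n} (h : i.1 + 1 < n) :
    part mu i.1 = part mu (i + 1).1 + mu.1 i := by
  have h1 := exponent_of_lt mu.1 h
  rw [exponent_eq_part, exponent_eq_part, val_add_one h] at h1
  rw [val_add_one h]
  omega

theorem part_zero_add (mu : Weight n k) : part mu 0 + mu.1 (nodeN n) = k := by
  have h1 := exponent_zero mu.1
  rw [exponent_eq_part, mu.2, Fin.val_zero] at h1
  have := NeZero.pos n
  omega

/-- The boxes in the last row count the columns of height n. With no box in the first row, the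
equation at the affine node says that deleting these columns enlarges the affine label by their
number. -/
theorem represents_iff_boxes {lam : YoungDiagram} {mu nu : Weight n k} {b : Fin n → ℕ}
    (hrow : ∀ i : Fin n, lam.rowLen i = part mu i + b i) (hlast : lam.rowLen n = 0)
    (h0 : b 0 = 0) :
    Represents lam nu ↔ ∀ i, nu.1 i + b (i + 1) = mu.1 i + b i := by
  have hN : lam.rowLen (n - 1) = b (nodeN n) := by
    have h1 := hrow (nodeN n)
    have h2 : (nodeN n).1 = n - 1 := rfl
    rw [h2, part_eq_zero mu (by omega)] at h1
    omega
  have hz : lam.rowLen 0 = part mu 0 := by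
    have := hrow 0
    rw [Fin.val_zero] at this
    omega
  have hle : ∀ i : Fin n, lam.rowLen (n - 1) ≤ lam.rowLen i := fun i =>
    lam.rowLen_anti i (n - 1) (by have := i.2; omega)
  rw [represents_iff, hN]
  have hmu := part_zero_add mu
  have hnu := part_zero_add nu
  constructor
  · rintro ⟨-, -, h⟩ i
    by_cases hi : i.1 + 1 < n
    · have h1 := h i
      have h2 := h (i + 1).1
      have h3 := hrow i
      have h4 := hrow (i + 1)
      have h5 := part_of_lt mu hi
      have h6 := part_of_lt nu hi
      have h7 := hle i
      have h8 := hle (i + 1)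
      omega
    · have h1 := h 0
      have h2 := hle 0
      rw [Fin.val_zero] at h2
      rw [add_one_eq_zero hi, eq_nodeN_iff.2 hi]
      omega
  · intro h
    refine ⟨hlast, by omega, fun i => ?_⟩
    by_cases hi : i < n
    · have hadd := addable_of_eq h
      have h1 := exponent_addBoxes hadd ⟨i, hi⟩
      rw [(addBoxes_eq_iff hadd).2 h, exponent_eq_part, exponent_eq_part] at h1
      have h2 := hrow ⟨i, hi⟩
      dsimp only at h1 h2
      omega
    · rw [part_eq_zero nu (by omega)]
      have := lam.rowLen_anti n i (by omega)
      omega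

theorem exists_boxes {lam : YoungDiagram} {mu nu : Weight n k} (hrep : Represents lam nu)
    (h0 : lam.rowLen 0 = (diagram mu).rowLen 0) (hle : diagram mu ≤ lam) :
    ∃ b : Fin n → ℕ, (∀ i : Fin n, lam.rowLen i = part mu i + b i) ∧ b 0 = 0 ∧
      ∑ i, b i = (lam.cells \ (diagram mu).cells).card ∧
      ∀ i, nu.1 i + b (i + 1) = mu.1 i + b i := by
  have hlast := (represents_iff.1 hrep).1
  have h1 : ∀ i, part mu i ≤ lam.rowLen i := fun i => by
    rw [← rowLen_diagram]
    exact le_iff_rowLen.1 hle i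
  have hrow : ∀ i : Fin n, lam.rowLen i = part mu i + (lam.rowLen i - part mu i) := fun i => by
    have := h1 i
    omega
  have hb0 : lam.rowLen (0 : Fin n).1 - part mu (0 : Fin n).1 = 0 := by
    rw [Fin.val_zero, h0, rowLen_diagram]
    omega
  refine ⟨fun i => lam.rowLen i - part mu i, hrow, hb0, ?_,
    (represents_iff_boxes hrow hlast hb0).1 hrep⟩
  rw [card_cells_sdiff hlast]
  simp only [rowLen_diagram]

/-- The candidate row lengths decrease because their consecutive differences are the labels of `nu`.
-/
theorem exists_diagram {mu nu : Weight n k} {b : Fin n → ℕ} (h0 : b 0 = 0)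
    (hb : ∀ i, nu.1 i + b (i + 1) = mu.1 i + b i) :
    ∃ lam : YoungDiagram, Represents lam nu ∧ lam.rowLen 0 = (diagram mu).rowLen 0 ∧
      diagram mu ≤ lam ∧ (lam.cells \ (diagram mu).cells).card = ∑ i, b i ∧
      (∀ i : Fin n, lam.rowLen i = part mu i + b i) ∧ ∀ i, n ≤ i → lam.rowLen i = 0 := by
  set f : ℕ → ℕ := fun i => if h : i < n then part mu i + b ⟨i, h⟩ else 0 with hf
  have hanti : Antitone f := by
    refine antitone_nat_of_succ_le fun i => ?_
    by_cases hi : i + 1 < n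
    · have h1 := part_of_lt mu (i := ⟨i, by omega⟩) hi
      have h2 := hb ⟨i, by omega⟩
      have h3 : (⟨i, by omega⟩ + 1 : Fin n) = ⟨i + 1, hi⟩ := Fin.ext (val_add_one hi)
      rw [h3] at h1 h2
      simp only [hf, dif_pos hi, dif_pos (by omega : i < n)]
      dsimp only at h1
      omega
    · simp only [hf, dif_neg hi]
      exact Nat.zero_le _
  have hfn : ∀ i, n ≤ i → f i = 0 := fun i hi => dif_neg (by omega)
  have hlen := rowLen_ofRows hanti (hfn n le_rfl)
  have hrow : ∀ i : Fin n, (ofRows n f hanti).rowLen i = part mu i + b i := fun i => by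
    rw [hlen]
    exact dif_pos i.2
  have hlast : (ofRows n f hanti).rowLen n = 0 := by rw [hlen, hfn n le_rfl]
  refine ⟨ofRows n f hanti, (represents_iff_boxes hrow hlast h0).2 hb, ?_, ?_, ?_, hrow,
    fun i hi => by rw [hlen, hfn i hi]⟩
  · have := hrow 0
    rw [Fin.val_zero, h0] at this
    rw [this, rowLen_diagram, add_zero]
  · refine le_iff_rowLen.2 fun i => ?_
    rw [rowLen_diagram]
    by_cases hi : i < n
    · have := hrow ⟨i, hi⟩
      dsimp only at this
      omega
    · rw [part_eq_zero mu (by omega)]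
      exact Nat.zero_le _
  · rw [card_cells_sdiff hlast]
    refine Finset.sum_congr rfl fun i _ => ?_
    rw [hrow, rowLen_diagram, Nat.add_sub_cancel_left]

theorem columnCase1_iff {r : ℕ} {mu nu : Weight n k} :
    ColumnCase1 r mu nu ↔ ∃ b : Fin n → ℕ, (∀ i, b i ≤ 1) ∧ b 0 = 0 ∧ ∑ i, b i = r ∧
      ∀ i, nu.1 i + b (i + 1) = mu.1 i + b i := by
  constructor
  · rintro ⟨lam, hrep, h0, hstrip⟩
    obtain ⟨hle, hcard, hv⟩ := isVerticalStrip_iff.1 hstrip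
    obtain ⟨b, hrow, hb0, hsum, hb⟩ := exists_boxes hrep h0 hle
    refine ⟨b, fun i => ?_, hb0, hsum.trans hcard, hb⟩
    have h1 := hv i
    rw [hrow, rowLen_diagram] at h1
    omega
  · rintro ⟨b, hb1, hb0, hsum, hb⟩
    obtain ⟨lam, hrep, h0, hle, hcard, hrow, hlast⟩ := exists_diagram hb0 hb
    refine ⟨lam, hrep, h0, isVerticalStrip_iff.2 ⟨hle, hcard.trans hsum, fun i => ?_⟩⟩
    rw [rowLen_diagram]
    by_cases hi : i < n
    · have h1 := hrow ⟨i, hi⟩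
      have h2 := hb1 ⟨i, hi⟩
      dsimp only at h1
      omega
    · rw [hlast i (by omega)]
      exact Nat.zero_le _

theorem rowCase_iff {r : ℕ} {mu nu : Weight n k} :
    RowCase r mu nu ↔ ∃ b : Fin n → ℕ, IsStrip mu.1 b ∧ b 0 = 0 ∧ ∑ i, b i = r ∧
      ∀ i, nu.1 i + b (i + 1) = mu.1 i + b i := by
  constructor
  · rintro ⟨lam, hrep, h0, hstrip⟩
    obtain ⟨hle, hcard, hh⟩ := isHorizontalStrip_iff.1 hstrip
    obtain ⟨b, hrow, hb0, hsum, hb⟩ := exists_boxes hrep h0 hle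
    refine ⟨b, fun i => ?_, hb0, hsum.trans hcard, hb⟩
    by_cases hi : i.1 + 1 < n
    · have h1 := hh i
      have h2 := part_of_lt mu hi
      rw [← val_add_one hi, hrow, rowLen_diagram] at h1
      omega
    · rw [add_one_eq_zero hi, hb0]
      exact Nat.zero_le _
  · rintro ⟨b, hb1, hb0, hsum, hb⟩
    obtain ⟨lam, hrep, h0, hle, hcard, hrow, hlast⟩ := exists_diagram hb0 hb
    refine ⟨lam, hrep, h0, isHorizontalStrip_iff.2 ⟨hle, hcard.trans hsum, fun i => ?_⟩⟩
    rw [rowLen_diagram]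
    by_cases hi : i + 1 < n
    · have h1 := hb1 ⟨i, by omega⟩
      have h2 := part_of_lt mu (i := ⟨i, by omega⟩) hi
      have h3 : (⟨i, by omega⟩ + 1 : Fin n) = ⟨i + 1, hi⟩ := Fin.ext (val_add_one hi)
      have h4 := hrow ⟨i + 1, hi⟩
      rw [h3] at h1 h2
      dsimp only at h2 h4
      omega
    · rw [hlast _ (by omega)]
      exact Nat.zero_le _

theorem columnCase2_iff (hn : 2 ≤ n) {r : ℕ} {mu nu : Weight n k} :
    ColumnCase2 r mu nu ↔
      ∃ s, s + 1 = r ∧ ColumnCase1 s (phiStar (node1 n) mu) (phiStar (nodeN n) nu) := by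
  have h1 : (diagram mu).rowLen 0 + 1 = (diagram (phiStar (node1 n) mu)).rowLen 0 := by
    have h2 := part_zero_add mu
    have h3 := part_zero_add (phiStar (node1 n) mu)
    have h4 : (phiStar (node1 n) mu).1 (nodeN n) = mu.1 (nodeN n) :=
      if_neg fun h => by
        have := congrArg Fin.val h
        simp only [nodeN, node1, Fin.val_zero] at this
        omega
    rw [rowLen_diagram, rowLen_diagram]
    omega
  rw [ColumnCase2, h1]
  constructor
  · rintro ⟨lam, hrep, h0, s, hs, hstrip⟩
    exact ⟨s, hs, lam, hrep, h0, hstrip⟩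
  · rintro ⟨s, hs, lam, hrep, h0, hstrip⟩
    exact ⟨lam, hrep, h0, s, hs, hstrip⟩

/-- One box in the first row. -/
def firstBox (i : Fin n) : ℕ := if i = 0 then 1 else 0

theorem firstBox_zero : firstBox (0 : Fin n) = 1 := if_pos rfl

theorem sum_add_firstBox (b : Fin n → ℕ) : ∑ i, (b i + firstBox i) = ∑ i, b i + 1 := by
  rw [Finset.sum_add_distrib]
  simp [firstBox]

theorem exists_eq_add_firstBox {b : Fin n → ℕ} (h : 0 < b 0) :
    ∃ a : Fin n → ℕ, b = fun i => a i + firstBox i := by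
  refine ⟨fun i => b i - firstBox i, funext fun i => ?_⟩
  dsimp only [firstBox]
  split_ifs with hi
  · subst hi
    omega
  · omega

theorem firstBox_add_one (i : Fin n) : firstBox (i + 1) = if i = nodeN n then 1 else 0 :=
  if_congr add_one_eq_zero_iff rfl rfl

/-- A box in the first row adds 1 on the right at node 1 and on the left at node n; both can be
absorbed into the labels, at the price of one level. -/
theorem phiStar_boxes_iff {mu nu : Weight n k} {a : Fin n → ℕ} :
    (∀ i, (phiStar (nodeN n) nu).1 i + a (i + 1) = (phiStar (node1 n) mu).1 i + a i) ↔
      ∀ i, nu.1 i + (a (i + 1) + firstBox (i + 1)) = mu.1 i + (a i + firstBox i) := by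
  refine forall_congr' fun i => ?_
  rw [phiStar_apply, phiStar_apply, firstBox_add_one, firstBox, node1]
  omega

/-- The same box is cancelled from the opposite sides, which lowers the level instead of raising it.
-/
theorem phi_boxes_iff {mu nu : Weight n k} (hmu : 0 < mu.1 (nodeN n)) (hnu : 0 < nu.1 (node1 n))
    {a : Fin n → ℕ} :
    (∀ i, (phi (node1 n) nu hnu).1 i + a (i + 1) = (phi (nodeN n) mu hmu).1 i + a i) ↔
      ∀ i, nu.1 i + (a (i + 1) + firstBox (i + 1)) = mu.1 i + (a i + firstBox i) := by
  refine forall_congr' fun i => ?_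
  have h1 : (phi (node1 n) nu hnu).1 i + (if i = 0 then 1 else 0) = nu.1 i :=
    phi_apply_add (node1 n) i nu hnu
  have h2 := phi_apply_add (nodeN n) i mu hmu
  rw [firstBox_add_one, firstBox]
  omega

theorem isStrip_phi_iff {mu : Weight n k} (hmu : 0 < mu.1 (nodeN n)) {a : Fin n → ℕ} :
    IsStrip (phi (nodeN n) mu hmu).1 a ↔ IsStrip mu.1 fun i => a i + firstBox i := by
  refine forall_congr' fun i => ?_
  have h2 := phi_apply_add (nodeN n) i mu hmu
  dsimp only
  rw [firstBox_add_one]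
  omega

theorem columnCase_iff (hn : 2 ≤ n) {r : ℕ} {mu nu : Weight n k} :
    ColumnCase1 r mu nu ∨ ColumnCase2 r mu nu ↔
      ∃ b : Fin n → ℕ, (∀ i, b i ≤ 1) ∧ ∑ i, b i = r ∧
        ∀ i, nu.1 i + b (i + 1) = mu.1 i + b i := by
  rw [columnCase2_iff hn, columnCase1_iff]
  simp only [columnCase1_iff]
  constructor
  · rintro (⟨b, hb1, -, hsum, hb⟩ | ⟨s, rfl, a, ha1, ha0, hsum, ha⟩)
    · exact ⟨b, hb1, hsum, hb⟩
    · refine ⟨fun i => a i + firstBox i, fun i => ?_, by rw [sum_add_firstBox, hsum],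
        phiStar_boxes_iff.1 ha⟩
      have := ha1 i
      dsimp only [firstBox]
      split_ifs with hi
      · rw [hi, ha0]
      · exact this
  · rintro ⟨b, hb1, hsum, hb⟩
    rcases Nat.eq_zero_or_pos (b 0) with h0 | h0
    · exact Or.inl ⟨b, hb1, h0, hsum, hb⟩
    -- As `b 0 ≤ 1`, the remaining boxes `a` avoid the first row, as the first case at level k + 1
    -- requires.
    · obtain ⟨a, rfl⟩ := exists_eq_add_firstBox h0
      refine Or.inr ⟨∑ i, a i, by rw [← hsum, sum_add_firstBox], a, fun i => ?_, ?_, rfl,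
        phiStar_boxes_iff.2 hb⟩
      · exact (Nat.le_add_right _ _).trans (hb1 i)
      · have h1 : a 0 + firstBox (0 : Fin n) ≤ 1 := hb1 0
        rw [firstBox_zero] at h1
        omega

end Diagrams

end SuFusion

theorem mainTheorem4 {n : ℕ} [NeZero n] (hn : 2 ≤ n) (k : ℕ) (mu nu : SuFusion.Weight n k) :
    (∀ (r : ℕ) (hr : r < n) (hk : r = 0 ∨ 0 < k),
      ((SuFusion.ColumnCase1 r mu nu ∨ SuFusion.ColumnCase2 r mu nu) →
        SuFusion.fusionCoeff (SuFusion.columnWeight n k r hr hk) mu nu = 1) ∧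
      (¬ (SuFusion.ColumnCase1 r mu nu ∨ SuFusion.ColumnCase2 r mu nu) →
        SuFusion.fusionCoeff (SuFusion.columnWeight n k r hr hk) mu nu = 0)) ∧
    (∀ (r : ℕ) (hr : r ≤ k),
      (SuFusion.RowCase r mu nu →
        SuFusion.fusionCoeff (SuFusion.rowWeight n k r hn hr) mu nu = 1) ∧
      (¬ SuFusion.RowCase r mu nu →
        (∀ (_ : 1 ≤ r) (hmu : 0 < mu.1 (SuFusion.nodeN n)) (hnu : 0 < nu.1 (SuFusion.node1 n)),
          SuFusion.fusionCoeff (SuFusion.rowWeight n k r hn hr) mu nu =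
            SuFusion.fusionCoeff
              (SuFusion.rowWeight n (k - 1) (r - 1) hn (Nat.sub_le_sub_right hr 1))
              (SuFusion.phi (SuFusion.nodeN n) mu hmu)
              (SuFusion.phi (SuFusion.node1 n) nu hnu)) ∧
        ((r = 0 ∨ mu.1 (SuFusion.nodeN n) = 0 ∨ nu.1 (SuFusion.node1 n) = 0) →
          SuFusion.fusionCoeff (SuFusion.rowWeight n k r hn hr) mu nu = 0))) := by
  open SuFusion in
  refine ⟨fun r hr hk => ?_, fun r hr => ⟨fun h => ?_, fun h => ?_⟩⟩
  · rw [columnCase_iff hn, fusionCoeff_columnWeight hn]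
    exact ⟨fun h => if_pos h, fun h => if_neg h⟩
  · rw [fusionCoeff_rowWeight hn]
    obtain ⟨b, hb1, -, hsum, hb⟩ := rowCase_iff.1 h
    exact if_pos ⟨b, hb1, hsum, hb⟩
  · rw [rowCase_iff] at h
    -- A strip without a box in the first row would be an ordinary horizontal strip, which is
    -- excluded here.
    have hpos : ∀ b : Fin n → ℕ, IsStrip mu.1 b → ∑ i, b i = r →
        (∀ i, nu.1 i + b (i + 1) = mu.1 i + b i) → 0 < b 0 := by
      intro b hb1 hsum hb
      by_contra h0
      exact h ⟨b, hb1, by omega, hsum, hb⟩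
    refine ⟨fun hr1 hmu hnu => ?_, fun hzero => ?_⟩
    · classical
      rw [fusionCoeff_rowWeight hn, fusionCoeff_rowWeight hn]
      refine if_congr ⟨?_, ?_⟩ rfl rfl
      · rintro ⟨b, hb1, hsum, hb⟩
        obtain ⟨a, rfl⟩ := exists_eq_add_firstBox (hpos b hb1 hsum hb)
        rw [sum_add_firstBox] at hsum
        exact ⟨a, (isStrip_phi_iff hmu).2 hb1, by omega, (phi_boxes_iff hmu hnu).2 hb⟩
      · rintro ⟨a, ha1, hsum, ha⟩
        exact ⟨fun i => a i + firstBox i, (isStrip_phi_iff hmu).1 ha1,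
          by rw [sum_add_firstBox]; omega, (phi_boxes_iff hmu hnu).1 ha⟩
    · rw [fusionCoeff_rowWeight hn]
      refine if_neg ?_
      rintro ⟨b, hb1, hsum, hb⟩
      have h0 := hpos b hb1 hsum hb
      have h1 : b 0 ≤ ∑ i, b i :=
        Finset.single_le_sum (fun i _ => Nat.zero_le (b i)) (Finset.mem_univ 0)
      -- A box in the first row needs a positive affine label of `mu`. It also makes the label m_1
      -- of `nu` positive, since the strip bound at node 1 gives `b 1 ≤ mu.1 0`.
      have h2 := hb1 (nodeN n)
      rw [nodeN_add_one] at h2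
      have h3 := hb1 0
      have h4 := hb 0
      rw [node1] at hzero
      omega
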